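/- Let $\theta_3(x)=\sum_{n\in\mathbb Z}e^{-\pi n^2x}$ for $\operatorname{Re}x>0$, let $\sigma_3(z)=\frac{1}{\sqrt{1+z}}\,\theta_3\!\left(\frac{1-z}{1+z}\right)$ for complex $z$ with $|z|<1$ (principal square root), and let $\Phi=\frac{\Gamma(1/4)^8}{128\pi^4}$. Let $(d(n))_{n\ge0}$ be the sequence of real numbers defined by the Taylor expansion $$\sigma_3(z)=\theta_3(1)\sum_{n=0}^\infty\frac{d(n)}{(2n)!}\,\Phi^n z^{2n}\qquad(|z|<1);$$ it is part of the assertion that such an expansion with real $d(n)$ exists. Let $$U(t)=\frac{{}_2F_1(\tfrac34,\tfrac34;\tfrac32;4t)}{{}_2F_1(\tfrac14,\tfrac14;\tfrac12;4t)},\qquad V(t)=\sqrt{{}_2F_1(\tfrac14,\tfrac14;\tfrac12;4t)}\qquad(|t|<\tfrac14),$$ where ${}_2F_1(a,b;c;z)=\sum_{n=0}^\infty\frac{(a)_n(b)_n}{n!\,(c)_n}z^n$ for $|z|<1$, $(x)_n=x(x+1)\cdots(x+n-1)$, and the square root is the principal one. Then $$\sum_{n=0}^\infty\frac{d(n)}{2^n(2n)!}\,t^n\,U(t)^{2n}=V(t)\qquad\text{for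 all complex }t\text{ with }|t|<\tfrac14$$ (in particular the series converges), and $(d(n))_{n\ge0}$ is the unique sequence of real numbers with this property; it is even the only sequence of real numbers $(e(n))_{n\ge0}$ such that the identity with $e(n)$ in place of $d(n)$ holds (with a convergent series) for all real $t$ with $|t|<\tfrac14$. Here convergence means absolute convergence. -/

import Mathlib

noncomputable section

/-- The theta constant `θ₃(x) = ∑_{n ∈ ℤ} exp(-π n² x)`, meaningful for `Re x > 0`. -/
def thetaThree (x : ℂ) : ℂ :=
  ∑' n : ℤ, Complex.exp (-(Real.pi : ℂ) * (n : ℂ) ^ 2 * x)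

/-- The centered theta function `σ₃(z) = (1 + z)^(-1/2) θ₃((1 - z)/(1 + z))`, for `|z| < 1`
(principal branch of the square root). -/
def sigmaThree (z : ℂ) : ℂ :=
  1 / (1 + z) ^ (1 / 2 : ℂ) * thetaThree ((1 - z) / (1 + z))

/-- The constant `Φ = Γ(1/4)⁸ / (128 π⁴)`. -/
def thetaPhi : ℝ := Real.Gamma (1 / 4) ^ 8 / (128 * Real.pi ^ 4)

/-- The number `d(n)`, read off from the coefficient of `z^(2n)` in the Taylor expansion
`σ₃(z) = θ₃(1) ∑ d(n) Φⁿ z^(2n) / (2n)!` at `0`: that is, `d(n) = σ₃^(2n)(0) / (θ₃(1) Φⁿ)`.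
All these quotients are real numbers. -/
def dCoeff (n : ℕ) : ℝ :=
  (iteratedDeriv (2 * n) sigmaThree 0 / (thetaThree 1 * (thetaPhi : ℂ) ^ n)).re

/-- `U(t) = ₂F₁(3/4, 3/4; 3/2; 4t) / ₂F₁(1/4, 1/4; 1/2; 4t)`. -/
def genU (t : ℂ) : ℂ :=
  ordinaryHypergeometric (3 / 4 : ℂ) (3 / 4 : ℂ) (3 / 2 : ℂ) (4 * t) /
    ordinaryHypergeometric (1 / 4 : ℂ) (1 / 4 : ℂ) (1 / 2 : ℂ) (4 * t)

/-- `V(t) = √(₂F₁(1/4, 1/4; 1/2; 4t))`, with the principal branch of the square root. -/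
def genV (t : ℂ) : ℂ :=
  (ordinaryHypergeometric (1 / 4 : ℂ) (1 / 4 : ℂ) (1 / 2 : ℂ) (4 * t)) ^ (1 / 2 : ℂ)

/-- The sequence `e` satisfies, at the point `t`, the generating function identity
`∑ e(n) / (2ⁿ (2n)!) tⁿ U(t)^(2n) = V(t)`; convergence of the series is part of it. -/
def GenFunIdentityAt (e : ℕ → ℝ) (t : ℂ) : Prop :=
  HasSum (fun n : ℕ =>
    (e n : ℂ) / (2 ^ n * (Nat.factorial (2 * n) : ℂ)) * t ^ n * genU t ^ (2 * n)) (genV t)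

end

/-! For `x > 0` put `u = 1 - 2λ` with `λ = θ₂⁴/θ₃⁴`, and `z = (1 - x)/(1 + x)`. The complete
elliptic integral, written as a function `C(u)` centered at `λ = 1/2`, satisfies `C(u) = √2 π
θ₃(x)²` and, because `x ↦ 1/x` interchanges `θ₂` and `θ₄` up to the factor `√x`, also `C(-u) = √2 π
x θ₃(x)²`. The even and odd parts of `C` are multiples of `₂F₁(1/4,1/4;1/2;u²)` and `u
₂F₁(3/4,3/4;3/2;u²)`. With `4t = u²`, the sum of the two values gives `V(t) = σ₃(z)/θ₃(1)`, and the
quotient of difference by sum gives `t U(t)² = 2Φ z²`. At these points the identity is therefore the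
Taylor expansion of `σ₃` (`genV_centeredLambda`, `genU_centeredLambda`).

The value of `C(u)` comes from the arithmetic-geometric mean: doubling `x` performs one AGM step on
`(θ₃², θ₄²)`, Gauss's integral is invariant under such a step, and both entries tend to 1
(`agmIntegral_theta`).

As `x → 1` the points `t = u²/4` accumulate at 0, so the identity theorem extends the equality to
the disc once both sides are holomorphic there. This needs `|t U(t)²| < 2Φ` and a nonvanishing,
right-half-plane-valued `₂F₁(1/4,1/4;1/2;4t)`. Both follow because `C(u)` and `C(-u)` lie in the
open sector `|arg| < π/4` (`abs_im_lt_re_centeredElliptic`). For uniqueness, `t U(t)²` takes nonzero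
values accumulating at 0, which determines the coefficients of a power series in it. -/

open Filter Topology MeasureTheory Set

/-! ### Duplication and inversion formulas for the theta constants -/

/-- `θ₃(x)` as a real series. -/
noncomputable def realThetaThree (x : ℝ) : ℝ := ∑' n : ℤ, Real.exp (-Real.pi * (n : ℝ) ^ 2 * x)

/-- `θ₄(x) = ∑ (-1)ⁿ exp(-π n² x)`. -/
noncomputable def realThetaFour (x : ℝ) : ℝ :=
  ∑' n : ℤ, (-1 : ℝ) ^ n * Real.exp (-Real.pi * (n : ℝ) ^ 2 * x)

/-- `θ₂(x) = ∑ exp(-π (n + 1/2)² x)`. -/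
noncomputable def realThetaTwo (x : ℝ) : ℝ :=
  ∑' n : ℤ, Real.exp (-Real.pi * ((n : ℝ) + 1 / 2) ^ 2 * x)

/-- The two families are the classes of pairs with coordinates of equal and of opposite parity. This
change of lattice turns `a² + b²` into `2m² + 2n²`, respectively `2(m + 1/2)² + 2(n + 1/2)²`, and so
produces all the duplication formulas. -/
theorem tsum_int_prod_eq_add_parity (f : ℤ × ℤ → ℝ) (hf : Summable f) :
    ∑' p, f p = ∑' p : ℤ × ℤ, f (p.1 + p.2, p.1 - p.2) +
      ∑' p : ℤ × ℤ, f (p.1 + p.2 + 1, p.1 - p.2) := by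
  let g : (ℤ × ℤ) ⊕ (ℤ × ℤ) → ℤ × ℤ :=
    Sum.elim (fun p => (p.1 + p.2, p.1 - p.2)) (fun p => (p.1 + p.2 + 1, p.1 - p.2))
  have hg : Function.Bijective g := by
    constructor
    · rintro (⟨a, b⟩ | ⟨a, b⟩) (⟨c, d⟩ | ⟨c, d⟩) h <;> simp [g, Prod.ext_iff] at h <;>
        first | omega | (congr 2 <;> omega)
    · rintro ⟨a, b⟩
      rcases Int.even_or_odd (a - b) with ⟨k, hk⟩ | ⟨k, hk⟩
      · exact ⟨Sum.inl (b + k, k), by simp only [g, Sum.elim_inl, Prod.mk.injEq]; omega⟩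
      · exact ⟨Sum.inr (b + k, k), by simp only [g, Sum.elim_inr, Prod.mk.injEq]; omega⟩
  let e := Equiv.ofBijective g hg
  have hs : Summable (f ∘ e) := e.summable_iff.mpr hf
  rw [← e.tsum_eq f]
  exact Summable.tsum_sum (f := fun c => f (e c)) (hs.comp_injective Sum.inl_injective)
    (hs.comp_injective Sum.inr_injective)

theorem tsum_mul_tsum_eq_add_parity {f g : ℤ → ℝ} (hf : Summable f) (hg : Summable g) :
    (∑' n, f n) * ∑' n, g n = ∑' p : ℤ × ℤ, f (p.1 + p.2) * g (p.1 - p.2) +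
      ∑' p : ℤ × ℤ, f (p.1 + p.2 + 1) * g (p.1 - p.2) := by
  rw [tsum_mul_tsum_of_summable_norm hf.norm hg.norm]
  exact tsum_int_prod_eq_add_parity (fun z => f z.1 * g z.2)
    (summable_mul_of_summable_norm hf.norm hg.norm)

/-- Completing the square: up to the factor `exp(-π c² x)` the terms are norms of the terms of the
two-variable Jacobi theta series at `(icx, ix)`. -/
theorem summable_exp_neg_shifted_sq (c : ℝ) {x : ℝ} (hx : 0 < x) :
    Summable fun n : ℤ => Real.exp (-Real.pi * ((n : ℝ) + c) ^ 2 * x) := by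
  have h := ((summable_jacobiTheta₂_term_iff (Complex.I * (c * x : ℝ)) (Complex.I * (x : ℝ))).mpr
    (by simpa using hx)).norm.mul_left (Real.exp (-Real.pi * c ^ 2 * x))
  refine h.congr fun n => ?_
  rw [norm_jacobiTheta₂_term, ← Real.exp_add]
  congr 1
  simp only [Complex.mul_im, Complex.I_re, Complex.I_im, Complex.ofReal_re, Complex.ofReal_im]
  ring

theorem summable_realThetaThree {x : ℝ} (hx : 0 < x) :
    Summable fun n : ℤ => Real.exp (-Real.pi * (n : ℝ) ^ 2 * x) := by
  simpa using summable_exp_neg_shifted_sq 0 hx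

theorem summable_neg_one_zpow_mul {f : ℤ → ℝ} (hf : Summable f) :
    Summable fun n : ℤ => (-1 : ℝ) ^ n * f n := by
  refine Summable.of_norm (hf.norm.congr fun n => ?_)
  simp [norm_mul, norm_zpow]

theorem summable_realThetaFour {x : ℝ} (hx : 0 < x) :
    Summable fun n : ℤ => (-1 : ℝ) ^ n * Real.exp (-Real.pi * (n : ℝ) ^ 2 * x) :=
  summable_neg_one_zpow_mul (summable_realThetaThree hx)

theorem realThetaThree_pos {x : ℝ} (hx : 0 < x) : 0 < realThetaThree x :=
  (summable_realThetaThree hx).tsum_pos (fun _ => (Real.exp_pos _).le) 0 (Real.exp_pos _)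

theorem realThetaTwo_pos {x : ℝ} (hx : 0 < x) : 0 < realThetaTwo x :=
  (summable_exp_neg_shifted_sq _ hx).tsum_pos (fun _ => (Real.exp_pos _).le) 0 (Real.exp_pos _)

theorem realThetaThree_sq {x : ℝ} (hx : 0 < x) :
    realThetaThree x ^ 2 = realThetaThree (2 * x) ^ 2 + realThetaTwo (2 * x) ^ 2 := by
  have h2 : 0 < 2 * x := by linarith
  simp only [sq (realThetaThree _), sq (realThetaTwo _)]
  unfold realThetaThree realThetaTwo
  rw [tsum_mul_tsum_eq_add_parity (summable_realThetaThree hx) (summable_realThetaThree hx),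
    tsum_mul_tsum_of_summable_norm (summable_realThetaThree h2).norm
      (summable_realThetaThree h2).norm,
    tsum_mul_tsum_of_summable_norm (summable_exp_neg_shifted_sq _ h2).norm
      (summable_exp_neg_shifted_sq _ h2).norm]
  congr 1 <;> refine tsum_congr fun p => ?_ <;> simp only [← Real.exp_add] <;> congr 1 <;>
    push_cast <;> ring

theorem realThetaFour_sq {x : ℝ} (hx : 0 < x) :
    realThetaFour x ^ 2 = realThetaThree (2 * x) ^ 2 - realThetaTwo (2 * x) ^ 2 := by
  have h2 : 0 < 2 * x := by linarith
  simp only [sq (realThetaThree _), sq (realThetaTwo _), sq (realThetaFour _), sub_eq_add_neg]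
  unfold realThetaThree realThetaTwo realThetaFour
  rw [tsum_mul_tsum_eq_add_parity (summable_realThetaFour hx) (summable_realThetaFour hx),
    tsum_mul_tsum_of_summable_norm (summable_realThetaThree h2).norm
      (summable_realThetaThree h2).norm,
    tsum_mul_tsum_of_summable_norm (summable_exp_neg_shifted_sq _ h2).norm
      (summable_exp_neg_shifted_sq _ h2).norm, ← tsum_neg]
  congr 1 <;> refine tsum_congr fun p => ?_ <;>
    rw [mul_mul_mul_comm, ← zpow_add₀ (by norm_num), ← Real.exp_add, ← Real.exp_add]
  · rw [Even.neg_one_zpow ⟨p.1, by ring⟩, one_mul]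
    congr 1
    push_cast
    ring
  · rw [Odd.neg_one_zpow ⟨p.1, by ring⟩, neg_one_mul]
    congr 2
    push_cast
    ring

/-- The involution `n ↦ -1 - n` preserves `(n + 1/2)²` and reverses the sign. This kills the
half-integer part of `θ₃ θ₄`. -/
theorem tsum_neg_one_zpow_mul_exp_shifted_sq (x : ℝ) :
    ∑' n : ℤ, (-1 : ℝ) ^ n * Real.exp (-Real.pi * ((n : ℝ) + 1 / 2) ^ 2 * x) = 0 := by
  have h := (Equiv.subLeft (-1 : ℤ)).tsum_eq
    (fun n : ℤ => (-1 : ℝ) ^ n * Real.exp (-Real.pi * ((n : ℝ) + 1 / 2) ^ 2 * x))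
  have h' : ∀ n : ℤ, (-1 : ℝ) ^ (Equiv.subLeft (-1 : ℤ) n) *
      Real.exp (-Real.pi * (((Equiv.subLeft (-1 : ℤ) n : ℤ) : ℝ) + 1 / 2) ^ 2 * x) =
      -((-1 : ℝ) ^ n * Real.exp (-Real.pi * ((n : ℝ) + 1 / 2) ^ 2 * x)) := by
    intro n
    rw [Equiv.subLeft_apply, zpow_sub₀ (by norm_num), ← neg_mul]
    congr 1
    · rcases Int.even_or_odd n with hn | hn <;> simp [hn.neg_one_zpow]
    · congr 1
      push_cast
      ring
  rw [tsum_congr h', tsum_neg] at h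
  linarith

theorem realThetaThree_mul_realThetaFour {x : ℝ} (hx : 0 < x) :
    realThetaThree x * realThetaFour x = realThetaFour (2 * x) ^ 2 := by
  have h2 : 0 < 2 * x := by linarith
  have hs := summable_neg_one_zpow_mul (summable_exp_neg_shifted_sq (1 / 2) h2)
  simp only [sq (realThetaFour _)]
  unfold realThetaThree realThetaFour
  rw [tsum_mul_tsum_eq_add_parity (summable_realThetaThree hx) (summable_realThetaFour hx),
    tsum_mul_tsum_of_summable_norm (summable_realThetaFour h2).norm
      (summable_realThetaFour h2).norm]
  have h0 := tsum_mul_tsum_of_summable_norm hs.norm hs.norm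
  rw [tsum_neg_one_zpow_mul_exp_shifted_sq, zero_mul] at h0
  have hsign : ∀ p : ℤ × ℤ, (-1 : ℝ) ^ (p.1 - p.2) = (-1) ^ p.1 * (-1) ^ p.2 := by
    intro p
    rw [zpow_sub₀ (by norm_num)]
    rcases Int.even_or_odd p.2 with hn | hn <;> simp [hn.neg_one_zpow, div_neg]
  refine Eq.trans ?_ (add_zero _)
  rw [h0]
  congr 1 <;> refine tsum_congr fun p => ?_ <;>
    rw [mul_mul_mul_comm, mul_left_comm, hsign, ← Real.exp_add, ← Real.exp_add] <;> congr 2 <;>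
    push_cast <;> ring

theorem realThetaTwo_sq {x : ℝ} (hx : 0 < x) :
    realThetaTwo x ^ 2 = 2 * realThetaTwo (2 * x) * realThetaThree (2 * x) := by
  have h2 : 0 < 2 * x := by linarith
  have key : (∑' n : ℤ, Real.exp (-Real.pi * ((n : ℝ) + 1 / 2) ^ 2 * (2 * x))) *
      ∑' n : ℤ, Real.exp (-Real.pi * (n : ℝ) ^ 2 * (2 * x)) =
      ∑' n : ℤ × ℤ, Real.exp (-Real.pi * ((n.1 : ℝ) + 1 / 2) ^ 2 * (2 * x)) *
        Real.exp (-Real.pi * (n.2 : ℝ) ^ 2 * (2 * x)) :=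
    tsum_mul_tsum_of_summable_norm (summable_exp_neg_shifted_sq _ h2).norm
      (summable_realThetaThree h2).norm
  -- The opposite-parity class gives the exponents `2(m + 1)² + 2(n + 1/2)²`, hence the same product
  -- after shifting `m` by one.
  have key' : (∑' n : ℤ, Real.exp (-Real.pi * ((n : ℝ) + 1 / 2) ^ 2 * (2 * x))) *
      ∑' n : ℤ, Real.exp (-Real.pi * (n : ℝ) ^ 2 * (2 * x)) =
      ∑' n : ℤ × ℤ, Real.exp (-Real.pi * ((n.1 : ℝ) + 1) ^ 2 * (2 * x)) *
        Real.exp (-Real.pi * ((n.2 : ℝ) + 1 / 2) ^ 2 * (2 * x)) := by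
    have h1 : Summable fun n : ℤ => Real.exp (-Real.pi * ((n : ℝ) + 1) ^ 2 * (2 * x)) :=
      summable_exp_neg_shifted_sq 1 h2
    rw [← (Equiv.addRight (1 : ℤ)).tsum_eq
      (fun n : ℤ => Real.exp (-Real.pi * (n : ℝ) ^ 2 * (2 * x))), mul_comm]
    simp only [Equiv.coe_addRight, Int.cast_add, Int.cast_one]
    exact tsum_mul_tsum_of_summable_norm h1.norm (summable_exp_neg_shifted_sq _ h2).norm
  simp only [sq (realThetaTwo _), mul_assoc, two_mul (realThetaTwo _ * _)]
  unfold realThetaThree realThetaTwo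
  rw [tsum_mul_tsum_eq_add_parity (summable_exp_neg_shifted_sq _ hx)
    (summable_exp_neg_shifted_sq _ hx)]
  refine congrArg₂ _ (Eq.trans ?_ key.symm) (Eq.trans ?_ key'.symm) <;>
    refine tsum_congr fun p => ?_ <;> simp only [← Real.exp_add] <;> congr 1 <;>
    push_cast <;> ring

/-- Jacobi's identity `θ₃⁴ = θ₂⁴ + θ₄⁴`. -/
theorem realThetaThree_pow_four {x : ℝ} (hx : 0 < x) :
    realThetaThree x ^ 4 = realThetaTwo x ^ 4 + realThetaFour x ^ 4 := by
  linear_combination (realThetaThree x ^ 2 + realThetaThree (2 * x) ^ 2 +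
    realThetaTwo (2 * x) ^ 2) * realThetaThree_sq hx
    - (realThetaFour x ^ 2 + realThetaThree (2 * x) ^ 2 -
      realThetaTwo (2 * x) ^ 2) * realThetaFour_sq hx
    - (realThetaTwo x ^ 2 + 2 * realThetaTwo (2 * x) * realThetaThree (2 * x)) * realThetaTwo_sq hx

theorem realThetaThree_inv {x : ℝ} (hx : 0 < x) :
    realThetaThree x⁻¹ = √x * realThetaThree x := by
  have h := Real.tsum_exp_neg_mul_int_sq hx
  have hs : 0 < √x := Real.sqrt_pos.mpr hx
  rw [← Real.sqrt_eq_rpow] at h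
  have e1 : realThetaThree x = ∑' n : ℤ, Real.exp (-Real.pi * x * (n : ℝ) ^ 2) :=
    tsum_congr fun n => by ring_nf
  have e2 : realThetaThree x⁻¹ = ∑' n : ℤ, Real.exp (-Real.pi / x * (n : ℝ) ^ 2) :=
    tsum_congr fun n => by ring_nf
  rw [e1, e2, h]
  field_simp

/-- Poisson summation with linear coefficient `i/2`: on one side it produces the signs `(-1)ⁿ`, on
the other the shift `i · i/2 = -1/2`, which becomes `+1/2` by reindexing. -/
theorem realThetaTwo_inv {x : ℝ} (hx : 0 < x) :
    realThetaTwo x⁻¹ = √x * realThetaFour x := by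
  have h := Complex.tsum_exp_neg_quadratic (a := (x : ℂ)) (by simpa using hx) (Complex.I / 2)
  have hs : 0 < √x := Real.sqrt_pos.mpr hx
  have e1 : ((realThetaFour x : ℝ) : ℂ) = ∑' n : ℤ, Complex.exp (-Real.pi * x * (n : ℂ) ^ 2 +
      2 * Real.pi * (Complex.I / 2) * n) := by
    unfold realThetaFour
    rw [Complex.ofReal_tsum]
    refine tsum_congr fun n => ?_
    rw [Complex.exp_add, show (2 * Real.pi * (Complex.I / 2) * n : ℂ) =
      n * (Real.pi * Complex.I) by ring, Complex.exp_int_mul, Complex.exp_pi_mul_I]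
    push_cast
    rw [mul_comm]
    ring_nf
  have e2 : ((realThetaTwo x⁻¹ : ℝ) : ℂ) = ∑' n : ℤ, Complex.exp (-Real.pi / x *
      ((n : ℂ) + Complex.I * (Complex.I / 2)) ^ 2) := by
    unfold realThetaTwo
    rw [Complex.ofReal_tsum, ← (Equiv.addRight (1 : ℤ)).tsum_eq (fun n : ℤ => Complex.exp
      (-Real.pi / x * ((n : ℂ) + Complex.I * (Complex.I / 2)) ^ 2))]
    refine tsum_congr fun n => ?_
    rw [show Complex.I * (Complex.I / 2) = -1 / 2 by
      rw [← mul_div_assoc, Complex.I_mul_I]]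
    push_cast [Equiv.coe_addRight]
    congr 1
    ring
  have e3 : (x : ℂ) ^ (1 / 2 : ℂ) = ((√x : ℝ) : ℂ) := by
    rw [Real.sqrt_eq_rpow, Complex.ofReal_cpow hx.le]
    norm_num
  rw [← e1, ← e2, e3] at h
  have h' : realThetaFour x = 1 / √x * realThetaTwo x⁻¹ := by exact_mod_cast h
  rw [h']
  field_simp

theorem realThetaFour_pos {x : ℝ} (hx : 0 < x) : 0 < realThetaFour x := by
  have h := realThetaTwo_inv hx
  have h2 := realThetaTwo_pos (inv_pos.mpr hx)
  rw [h] at h2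
  exact pos_of_mul_pos_right h2 (Real.sqrt_nonneg x)

theorem realThetaFour_inv {x : ℝ} (hx : 0 < x) :
    realThetaFour x⁻¹ = √x * realThetaTwo x := by
  have h := realThetaTwo_inv (inv_pos.mpr hx)
  rw [inv_inv, Real.sqrt_inv] at h
  have hs : 0 < √x := Real.sqrt_pos.mpr hx
  rw [h]
  field_simp

/-! ### The complex theta function: holomorphy and limit at infinity -/

theorem thetaThree_eq_jacobiTheta (x : ℂ) : thetaThree x = jacobiTheta (Complex.I * x) := by
  unfold thetaThree jacobiTheta
  refine tsum_congr fun n => ?_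
  congr 1
  linear_combination (-(Real.pi : ℂ) * (n : ℂ) ^ 2 * x) * Complex.I_mul_I

theorem thetaThree_ofReal (x : ℝ) : thetaThree x = (realThetaThree x : ℝ) := by
  unfold thetaThree realThetaThree
  rw [Complex.ofReal_tsum]
  refine tsum_congr fun n => ?_
  push_cast
  rfl

theorem differentiableAt_thetaThree {x : ℂ} (hx : 0 < x.re) : DifferentiableAt ℂ thetaThree x := by
  rw [funext thetaThree_eq_jacobiTheta]
  exact (differentiableAt_jacobiTheta (by simpa using hx)).comp x
    (differentiableAt_id.const_mul Complex.I)

theorem tendsto_realThetaThree_atTop : Tendsto realThetaThree atTop (𝓝 1) := by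
  have h1 : Tendsto (fun x : ℝ => Complex.I * (x : ℂ)) atTop (comap Complex.im atTop) := by
    rw [tendsto_comap_iff]
    exact tendsto_id.congr fun x => by simp
  have h2 := isBigO_at_im_infty_jacobiTheta_sub_one.comp_tendsto h1
  have h3 : Tendsto ((fun τ : ℂ => Real.exp (-Real.pi * τ.im)) ∘
      fun x : ℝ => Complex.I * (x : ℂ)) atTop (𝓝 0) := by
    have : Tendsto (fun x : ℝ => -Real.pi * x) atTop atBot :=
      tendsto_id.const_mul_atTop_of_neg (by linarith [Real.pi_pos])
    exact (Real.tendsto_exp_atBot.comp this).congr fun x => by simp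
  have h4 := (h2.trans_tendsto h3).add_const 1
  have h5 := (Complex.continuous_re.tendsto _).comp h4
  simp only [zero_add, Complex.one_re] at h5
  refine h5.congr fun x => ?_
  simp only [Function.comp_apply, sub_add_cancel]
  rw [← thetaThree_eq_jacobiTheta, thetaThree_ofReal, Complex.ofReal_re]

/-! ### Gauss's integral and the arithmetic-geometric mean -/

/-- Gauss's integral `∫₀^∞ dt / √((t² + a²)(t² + b²))`. -/
noncomputable def agmIntegral (a b : ℝ) : ℝ :=
  ∫ t in Ioi (0 : ℝ), (√((t ^ 2 + a ^ 2) * (t ^ 2 + b ^ 2)))⁻¹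

theorem agmIntegral_smul {c : ℝ} (hc : 0 < c) (a b : ℝ) :
    agmIntegral (c * a) (c * b) = c⁻¹ * agmIntegral a b := by
  have h := integral_comp_mul_left_Ioi
    (fun t : ℝ => (√((t ^ 2 + (c * a) ^ 2) * (t ^ 2 + (c * b) ^ 2)))⁻¹) 0 hc
  rw [mul_zero] at h
  unfold agmIntegral
  have h2 : ∀ t : ℝ, (√(((c * t) ^ 2 + (c * a) ^ 2) * ((c * t) ^ 2 + (c * b) ^ 2)))⁻¹ =
      (c ^ 2)⁻¹ * (√((t ^ 2 + a ^ 2) * (t ^ 2 + b ^ 2)))⁻¹ := by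
    intro t
    rw [show ((c * t) ^ 2 + (c * a) ^ 2) * ((c * t) ^ 2 + (c * b) ^ 2) =
      (c ^ 2) ^ 2 * ((t ^ 2 + a ^ 2) * (t ^ 2 + b ^ 2)) by ring,
      Real.sqrt_mul (by positivity), Real.sqrt_sq (by positivity), mul_inv]
  simp only [h2, smul_eq_mul] at h
  rw [integral_const_mul] at h
  field_simp at h ⊢
  linarith

/-- Invariance of Gauss's integral under one step of the arithmetic-geometric mean. -/
theorem agmIntegral_agm {a b : ℝ} (ha : 0 < a) (hb : 0 < b) :
    agmIntegral ((a + b) / 2) √(a * b) = agmIntegral a b := by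
  have hab : 0 < a * b := mul_pos ha hb
  set G : ℝ → ℝ := fun s =>
    (√((s ^ 2 + ((a + b) / 2) ^ 2) * (s ^ 2 + √(a * b) ^ 2)))⁻¹ with hG
  -- The substitution `s = (t - ab/t)/2` maps `(0, ∞)` bijectively onto the line; there `s² + ab =
  -- ((t + ab/t)/2)²` and `s² + ((a + b)/2)² = (t² + a²)(t² + b²)/(4t²)`.
  have hderiv : ∀ t ∈ Ioi (0 : ℝ), HasDerivWithinAt (fun t : ℝ => (t - a * b / t) / 2)
      ((1 + a * b / t ^ 2) / 2) (Ioi 0) t := by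
    intro t ht
    have ht0 : t ≠ 0 := (ne_of_gt ht)
    have h := (((hasDerivAt_id t).sub ((hasDerivAt_inv ht0).const_mul (a * b))).div_const
      2).hasDerivWithinAt (s := Ioi 0)
    refine (h.congr_deriv ?_).congr (fun y _ => ?_) ?_
    · field_simp
      ring
    · simp [div_eq_mul_inv]
    · simp [div_eq_mul_inv]
  have hinj : InjOn (fun t : ℝ => (t - a * b / t) / 2) (Ioi 0) := by
    intro s hs t ht hst
    have hs' : 0 < s := hs
    have ht' : 0 < t := ht
    have h1 : (s - t) * (s * t + a * b) = 0 := by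
      simp only at hst
      field_simp at hst
      linarith
    rcases mul_eq_zero.mp h1 with h | h
    · linarith
    · nlinarith [mul_pos hs' ht']
  have himage : (fun t : ℝ => (t - a * b / t) / 2) '' Ioi 0 = univ := by
    refine eq_univ_of_forall fun s => ?_
    have hlt : |s| < √(s ^ 2 + a * b) := by
      rw [← Real.sqrt_sq_eq_abs]
      exact Real.sqrt_lt_sqrt (sq_nonneg s) (by linarith)
    have hpos : 0 < s + √(s ^ 2 + a * b) := by linarith [neg_abs_le s]
    -- The positive root of `t² - 2st - ab = 0`.
    refine ⟨s + √(s ^ 2 + a * b), hpos, ?_⟩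
    have hsq : √(s ^ 2 + a * b) ^ 2 = s ^ 2 + a * b := Real.sq_sqrt (by positivity)
    simp only
    field_simp
    nlinarith
  have h := integral_image_eq_integral_abs_deriv_smul measurableSet_Ioi hderiv hinj G
  rw [himage, Measure.restrict_univ] at h
  have heven : ∫ s, G s = 2 * ∫ s in Ioi 0, G s := by
    rw [← integral_comp_abs]
    simp only [hG, sq_abs]
  rw [heven] at h
  have hpt : ∀ t ∈ Ioi (0 : ℝ), |(1 + a * b / t ^ 2) / 2| • G ((t - a * b / t) / 2) =
      2 * (√((t ^ 2 + a ^ 2) * (t ^ 2 + b ^ 2)))⁻¹ := by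
    intro t ht
    have ht0 : 0 < t := ht
    have e1 : (((t - a * b / t) / 2) ^ 2 + ((a + b) / 2) ^ 2) *
        (((t - a * b / t) / 2) ^ 2 + √(a * b) ^ 2) =
        ((t ^ 2 + a * b) / (4 * t ^ 2)) ^ 2 * ((t ^ 2 + a ^ 2) * (t ^ 2 + b ^ 2)) := by
      rw [Real.sq_sqrt hab.le]
      field_simp
      ring
    have e2 : |(1 + a * b / t ^ 2) / 2| = (t ^ 2 + a * b) / (2 * t ^ 2) := by
      rw [abs_of_pos (by positivity)]
      field_simp
    rw [hG]
    simp only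
    rw [e1, e2, Real.sqrt_mul (by positivity), Real.sqrt_sq (by positivity), smul_eq_mul]
    have : √((t ^ 2 + a ^ 2) * (t ^ 2 + b ^ 2)) ≠ 0 := by positivity
    field_simp
    norm_num
  rw [setIntegral_congr_fun measurableSet_Ioi hpt, integral_const_mul] at h
  unfold agmIntegral
  linarith

theorem tendsto_agmIntegral_of_tendsto_one {a b : ℕ → ℝ} (ha : Tendsto a atTop (𝓝 1))
    (hb : Tendsto b atTop (𝓝 1)) :
    Tendsto (fun n => agmIntegral (a n) (b n)) atTop (𝓝 (Real.pi / 2)) := by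
  have hval : ∫ t in Ioi (0 : ℝ), (1 + t ^ 2)⁻¹ = Real.pi / 2 := by
    rw [integral_Ioi_inv_one_add_sq, Real.arctan_zero, sub_zero]
  rw [← hval]
  have ha' : ∀ᶠ n in atTop, 1 / 2 < a n := ha.eventually_const_lt (by norm_num)
  have hb' : ∀ᶠ n in atTop, 1 / 2 < b n := hb.eventually_const_lt (by norm_num)
  -- Once both parameters exceed `1/2`, each factor under the root is at least `(1 + t²)/4`.
  refine tendsto_integral_filter_of_dominated_convergence (fun t => 4 * (1 + t ^ 2)⁻¹) ?_ ?_ ?_ ?_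
  · exact Eventually.of_forall fun n => Measurable.aestronglyMeasurable (by fun_prop)
  · filter_upwards [ha', hb'] with n h1 h2
    refine Eventually.of_forall fun t => ?_
    rw [Real.norm_of_nonneg (by positivity), ← div_eq_mul_inv, ← inv_div]
    refine inv_anti₀ (by positivity) (Real.le_sqrt_of_sq_le ?_)
    rw [sq]
    refine mul_le_mul ?_ ?_ (by positivity) (by positivity) <;> nlinarith [sq_nonneg t]
  · exact (integrable_inv_one_add_sq.const_mul 4).integrableOn
  · refine Eventually.of_forall fun t => ?_
    have h : Tendsto (fun n => (√((t ^ 2 + a n ^ 2) * (t ^ 2 + b n ^ 2)))⁻¹) atTop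
        (𝓝 (√((t ^ 2 + 1 ^ 2) * (t ^ 2 + 1 ^ 2)))⁻¹) := by
      refine Tendsto.inv₀ ?_ (by positivity)
      exact (((ha.pow 2).const_add _).mul ((hb.pow 2).const_add _)).sqrt
    rw [← sq, Real.sqrt_sq (by positivity), one_pow, add_comm (t ^ 2)] at h
    exact h

/-- By duplication `θ₄(x)² = 2θ₃(2x)² - θ₃(x)²`, so the limit of `θ₃` suffices. -/
theorem tendsto_realThetaFour_sq_atTop :
    Tendsto (fun x => realThetaFour x ^ 2) atTop (𝓝 1) := by
  have h1 := tendsto_realThetaThree_atTop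
  have h2 : Tendsto (fun x : ℝ => realThetaThree (2 * x)) atTop (𝓝 1) :=
    h1.comp (tendsto_id.const_mul_atTop two_pos)
  have h3 := ((h2.pow 2).const_mul 2).sub (h1.pow 2)
  norm_num at h3
  refine h3.congr' ?_
  filter_upwards [eventually_gt_atTop 0] with x hx
  linarith [realThetaThree_sq hx, realThetaFour_sq hx]

/-- Replacing `x` by `2x` is one AGM step for `(θ₃², θ₄²)`, so the integral is constant along `2ⁿ
x`, where the pair tends to `(1, 1)`. -/
theorem agmIntegral_theta {x : ℝ} (hx : 0 < x) :
    agmIntegral (realThetaThree x ^ 2) (realThetaFour x ^ 2) = Real.pi / 2 := by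
  have hstep : ∀ y : ℝ, 0 < y → agmIntegral (realThetaThree (2 * y) ^ 2)
      (realThetaFour (2 * y) ^ 2) = agmIntegral (realThetaThree y ^ 2) (realThetaFour y ^ 2) := by
    intro y hy
    have h3 := realThetaThree_pos hy
    have h4 := realThetaFour_pos hy
    rw [← agmIntegral_agm (pow_pos h3 2) (pow_pos h4 2)]
    congr 1
    · linarith [realThetaThree_sq hy, realThetaFour_sq hy]
    · rw [← realThetaThree_mul_realThetaFour hy, ← mul_pow, Real.sqrt_sq (by positivity)]
  have hiter : ∀ n : ℕ, agmIntegral (realThetaThree (2 ^ n * x) ^ 2)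
      (realThetaFour (2 ^ n * x) ^ 2) =
      agmIntegral (realThetaThree x ^ 2) (realThetaFour x ^ 2) := by
    intro n
    induction n with
    | zero => simp
    | succ n ih => rw [pow_succ' (2 : ℝ), mul_assoc, hstep _ (by positivity), ih]
  have hlim : Tendsto (fun n : ℕ => (2 : ℝ) ^ n * x) atTop atTop :=
    (tendsto_pow_atTop_atTop_of_one_lt one_lt_two).atTop_mul_const hx
  have h3 := (tendsto_realThetaThree_atTop.comp hlim).pow 2
  have h4 := tendsto_realThetaFour_sq_atTop.comp hlim
  rw [one_pow] at h3
  exact tendsto_nhds_unique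
    (tendsto_const_nhds.congr fun n => (hiter n).symm) (tendsto_agmIntegral_of_tendsto_one h3 h4)

theorem agmIntegral_one_theta_ratio {x : ℝ} (hx : 0 < x) :
    agmIntegral 1 (realThetaFour x ^ 2 / realThetaThree x ^ 2) =
      Real.pi / 2 * realThetaThree x ^ 2 := by
  have h3 := realThetaThree_pos hx
  have h := agmIntegral_smul (pow_pos h3 2) 1 (realThetaFour x ^ 2 / realThetaThree x ^ 2)
  rw [mul_one, mul_div_cancel₀ _ (pow_pos h3 2).ne', agmIntegral_theta hx] at h
  rw [h]
  field_simp

theorem agmIntegral_one_theta_ratio' {x : ℝ} (hx : 0 < x) :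
    agmIntegral 1 (realThetaTwo x ^ 2 / realThetaThree x ^ 2) =
      Real.pi / 2 * (x * realThetaThree x ^ 2) := by
  have h := agmIntegral_one_theta_ratio (inv_pos.mpr hx)
  rw [realThetaFour_inv hx, realThetaThree_inv hx, mul_pow, mul_pow, Real.sq_sqrt hx.le,
    mul_div_mul_left _ _ hx.ne'] at h
  exact h

/-! ### The elliptic integral as a beta-type integral -/

/-- The weight `y^(-3/4) (1 - y)^(-1/2)` on the unit interval. -/
noncomputable def quarterWeight (y : ℝ) : ℝ := y ^ (-3 / 4 : ℝ) * (1 - y) ^ (-1 / 2 : ℝ)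

/-- Substitute `y = (1 + 2t²)⁻²`. Then `√y` is rational in `t`, and `1 + u√y` contributes the factor
`t² + (1 + u)/2`. -/
theorem integral_quarterWeight_eq_agmIntegral {u : ℝ} (hu : -1 < u) :
    ∫ y in Ioo (0 : ℝ) 1, quarterWeight y * (1 + u * √y) ^ (-1 / 2 : ℝ) =
      2 * √2 * agmIntegral 1 √((1 + u) / 2) := by
  have hderiv : ∀ t ∈ Ioi (0 : ℝ), HasDerivWithinAt (fun t : ℝ => ((1 + 2 * t ^ 2) ^ 2)⁻¹)
      (-(8 * t / (1 + 2 * t ^ 2) ^ 3)) (Ioi 0) t := by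
    intro t _
    have h0 : (1 + 2 * t ^ 2) ^ 2 ≠ 0 := by positivity
    have h := (((((hasDerivAt_pow 2 t).const_mul 2).const_add 1).pow 2).inv h0).hasDerivWithinAt
      (s := Ioi 0)
    refine h.congr_deriv ?_
    simp
    field_simp
    ring
  have hinj : InjOn (fun t : ℝ => ((1 + 2 * t ^ 2) ^ 2)⁻¹) (Ioi 0) := by
    intro s hs t ht hst
    have hs' : 0 < s := hs
    have ht' : 0 < t := ht
    have h1 := inv_injective hst
    have h2 := (pow_left_inj₀ (by positivity) (by positivity) two_ne_zero).mp h1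
    exact (pow_left_inj₀ hs'.le ht'.le two_ne_zero).mp (by linarith)
  have himage : (fun t : ℝ => ((1 + 2 * t ^ 2) ^ 2)⁻¹) '' Ioi 0 = Ioo 0 1 := by
    ext y
    constructor
    · rintro ⟨t, ht, rfl⟩
      have ht' : 0 < t := ht
      exact ⟨by positivity, inv_lt_one_of_one_lt₀ (one_lt_pow₀ (by nlinarith) two_ne_zero)⟩
    · rintro ⟨hy0, hy1⟩
      have hs0 : 0 < √y := Real.sqrt_pos.mpr hy0
      have hs1 : √y < 1 := by rw [← Real.sqrt_one]; exact Real.sqrt_lt_sqrt hy0.le hy1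
      have h1 : 1 < (√y)⁻¹ := (one_lt_inv₀ hs0).mpr hs1
      refine ⟨√(((√y)⁻¹ - 1) / 2), Real.sqrt_pos.mpr (by linarith), ?_⟩
      simp only
      rw [Real.sq_sqrt (by linarith), show 1 + 2 * (((√y)⁻¹ - 1) / 2) = (√y)⁻¹ by ring, inv_pow,
        inv_inv, Real.sq_sqrt hy0.le]
  have h := integral_image_eq_integral_abs_deriv_smul measurableSet_Ioi hderiv hinj
    (fun y => quarterWeight y * (1 + u * √y) ^ (-1 / 2 : ℝ))
  rw [himage] at h
  rw [h]
  unfold agmIntegral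
  rw [← integral_const_mul]
  refine setIntegral_congr_fun measurableSet_Ioi fun t ht => ?_
  have ht' : 0 < t := ht
  have hs : 0 < 1 + 2 * t ^ 2 := by positivity
  have hsu : 0 < 1 + 2 * t ^ 2 + u := by nlinarith
  have hneg : ∀ z : ℝ, 0 ≤ z → z ^ (-1 / 2 : ℝ) = (√z)⁻¹ := by
    intro z hz
    rw [neg_div, Real.rpow_neg hz, Real.sqrt_eq_rpow]
  have e1 : (((1 + 2 * t ^ 2) ^ 2)⁻¹ : ℝ) ^ (-3 / 4 : ℝ) =
      (1 + 2 * t ^ 2) * √(1 + 2 * t ^ 2) := by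
    rw [neg_div, Real.inv_rpow (by positivity), Real.rpow_neg (by positivity), inv_inv,
      ← Real.rpow_natCast, ← Real.rpow_mul hs.le, Real.sqrt_eq_rpow,
      ← Real.rpow_one_add' hs.le (by norm_num)]
    norm_num
  have e2 : (1 - ((1 + 2 * t ^ 2) ^ 2)⁻¹ : ℝ) ^ (-1 / 2 : ℝ) =
      (1 + 2 * t ^ 2) / (2 * t * √(t ^ 2 + 1)) := by
    rw [show 1 - ((1 + 2 * t ^ 2) ^ 2)⁻¹ = (2 * t / (1 + 2 * t ^ 2)) ^ 2 * (t ^ 2 + 1) by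
      field_simp; ring, hneg _ (by positivity), Real.sqrt_mul (by positivity),
      Real.sqrt_sq (by positivity)]
    have : √(t ^ 2 + 1) ≠ 0 := by positivity
    field_simp
  have e3 : √(((1 + 2 * t ^ 2) ^ 2)⁻¹) = (1 + 2 * t ^ 2)⁻¹ := by
    rw [Real.sqrt_inv, Real.sqrt_sq hs.le]
  have e4 : (1 + u * (1 + 2 * t ^ 2)⁻¹) ^ (-1 / 2 : ℝ) =
      √(1 + 2 * t ^ 2) / √(1 + 2 * t ^ 2 + u) := by
    rw [show 1 + u * (1 + 2 * t ^ 2)⁻¹ = (1 + 2 * t ^ 2 + u) / (1 + 2 * t ^ 2) by field_simp,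
      hneg _ (by positivity), Real.sqrt_div hsu.le, inv_div]
  have e5 : √((t ^ 2 + 1 ^ 2) * (t ^ 2 + √((1 + u) / 2) ^ 2)) =
      √(t ^ 2 + 1) * (√(1 + 2 * t ^ 2 + u) / √2) := by
    rw [Real.sq_sqrt (by linarith), one_pow, Real.sqrt_mul (by positivity), ← Real.sqrt_div hsu.le]
    congr 2
    ring
  have e6 : |(-(8 * t / (1 + 2 * t ^ 2) ^ 3))| = 8 * t / (1 + 2 * t ^ 2) ^ 3 := by
    rw [abs_neg, abs_of_pos (by positivity)]
  simp only [quarterWeight, smul_eq_mul]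
  rw [e5, e6, e1, e2, e3, e4]
  have h1 : √(1 + 2 * t ^ 2) ^ 2 = 1 + 2 * t ^ 2 := Real.sq_sqrt hs.le
  have h2 : √(2 : ℝ) ^ 2 = 2 := Real.sq_sqrt (by norm_num)
  have h3 : 0 < √(t ^ 2 + 1) := by positivity
  have h4 : 0 < √(1 + 2 * t ^ 2 + u) := Real.sqrt_pos.mpr hsu
  field_simp
  rw [mul_comm (t ^ 2) 2, h1, h2]
  ring

/-! ### Binomial coefficients, beta moments and hypergeometric coefficients -/

/-- The coefficients `(1/2)ₙ / n!` of `(1 - w)^(-1/2)`. -/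
noncomputable def invSqrtCoeff (n : ℕ) : ℝ :=
  (ascPochhammer ℝ n).eval (1 / 2) / (Nat.factorial n : ℝ)

theorem invSqrtCoeff_zero : invSqrtCoeff 0 = 1 := by simp [invSqrtCoeff]

theorem invSqrtCoeff_succ (n : ℕ) :
    invSqrtCoeff (n + 1) = invSqrtCoeff n * ((n + 1 / 2) / (n + 1)) := by
  unfold invSqrtCoeff
  rw [ascPochhammer_succ_eval, Nat.factorial_succ]
  push_cast
  field_simp
  ring

theorem invSqrtCoeff_pos (n : ℕ) : 0 < invSqrtCoeff n :=
  div_pos (ascPochhammer_pos n _ (by norm_num)) (by positivity)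

theorem invSqrtCoeff_le_one (n : ℕ) : invSqrtCoeff n ≤ 1 := by
  induction n with
  | zero => exact invSqrtCoeff_zero.le
  | succ n ih =>
    rw [invSqrtCoeff_succ]
    refine mul_le_one₀ ih (by positivity) ?_
    rw [div_le_one (by positivity)]
    linarith

theorem hasSum_one_add_cpow_neg_half {w : ℂ} (hw : ‖w‖ < 1) :
    HasSum (fun n : ℕ => (invSqrtCoeff n : ℂ) * (-w) ^ n) ((1 + w) ^ (-1 / 2 : ℂ)) := by
  have h := (Complex.one_add_cpow_hasFPowerSeriesOnBall_zero (a := -1 / 2)).hasSum (y := w)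
    (by simpa [enorm_eq_nnnorm, ← NNReal.coe_lt_coe] using hw)
  rw [zero_add] at h
  refine (congrArg (HasSum · _) (funext fun n => ?_)).mpr h
  -- The parameter `b` occurs in both numerator and denominator and cancels; with `b = 1` its
  -- Pochhammer symbols are factorials.
  rw [binomialSeries_eq_ordinaryHypergeometricSeries (b := (1 : ℂ)) (fun k hk => by
    have := congrArg Complex.re hk
    simp only [Complex.natCast_re, Complex.neg_re, Complex.one_re] at this
    linarith [k.cast_nonneg (α := ℝ)]), FormalMultilinearSeries.compContinuousLinearMap_apply]
  have hcomp : (⇑(-(ContinuousLinearMap.id ℂ ℂ)) ∘ fun _ : Fin n => w) = fun _ => -w := by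
    ext i
    simp
  have hcast : (ascPochhammer ℂ n).eval (1 / 2) = (((ascPochhammer ℝ n).eval (1 / 2) : ℝ) : ℂ) := by
    induction n with
    | zero => simp
    | succ n ih =>
      rw [ascPochhammer_succ_eval, ascPochhammer_succ_eval, ih (by ext i; simp)]
      push_cast
      rfl
  rw [hcomp, ordinaryHypergeometricSeries_apply_eq, ascPochhammer_eval_one,
    show -(-1 / 2 : ℂ) = 1 / 2 by ring, hcast, smul_eq_mul, invSqrtCoeff]
  have : (n.factorial : ℂ) ≠ 0 := by exact_mod_cast n.factorial_ne_zero
  push_cast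
  field_simp

/-- The moments `∫₀¹ y^(n/2 - 3/4) (1 - y)^(-1/2) dy`. -/
noncomputable def quarterMoment (n : ℕ) : ℝ := ProbabilityTheory.beta (n / 2 + 1 / 4) (1 / 2)

theorem quarterMoment_pos (n : ℕ) : 0 < quarterMoment n :=
  ProbabilityTheory.beta_pos (by positivity) (by norm_num)

theorem quarterMoment_add_two (n : ℕ) :
    quarterMoment (n + 2) = (n / 2 + 1 / 4) / (n / 2 + 3 / 4) * quarterMoment n := by
  unfold quarterMoment ProbabilityTheory.beta
  have h1 : ((n + 2 : ℕ) : ℝ) / 2 + 1 / 4 = (n / 2 + 1 / 4 : ℝ) + 1 := by push_cast; ring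
  have h2 : ((n / 2 + 1 / 4 : ℝ) + 1) + 1 / 2 = (n / 2 + 1 / 4 + 1 / 2 : ℝ) + 1 := by ring
  have h3 : (n / 2 + 1 / 4 + 1 / 2 : ℝ) = n / 2 + 3 / 4 := by ring
  have hG : Real.Gamma (n / 2 + 3 / 4) ≠ 0 := (Real.Gamma_pos_of_pos (by positivity)).ne'
  rw [h1, h2, Real.Gamma_add_one (by positivity), Real.Gamma_add_one (by positivity), h3]
  field_simp

theorem quarterWeight_mul_sqrt_pow {y : ℝ} (hy : y ∈ Ioo (0 : ℝ) 1) (n : ℕ) :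
    quarterWeight y * √y ^ n =
      y ^ ((n / 2 + 1 / 4 : ℝ) - 1) * (1 - y) ^ ((1 / 2 : ℝ) - 1) := by
  have h : √y ^ n = y ^ (n / 2 : ℝ) := by
    rw [Real.sqrt_eq_rpow, ← Real.rpow_natCast, ← Real.rpow_mul hy.1.le]
    congr 1
    ring
  rw [h, quarterWeight, mul_right_comm, ← Real.rpow_add hy.1]
  congr 2 <;> ring

theorem ofReal_quarterWeight_mul_sqrt_pow {y : ℝ} (hy : y ∈ Ioo (0 : ℝ) 1) (n : ℕ) :
    ((quarterWeight y * √y ^ n : ℝ) : ℂ) =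
      (y : ℂ) ^ (((n / 2 + 1 / 4 : ℝ) : ℂ) - 1) * (1 - (y : ℂ)) ^ (((1 / 2 : ℝ) : ℂ) - 1) := by
  rw [quarterWeight_mul_sqrt_pow hy, Complex.ofReal_mul, Complex.ofReal_cpow hy.1.le,
    Complex.ofReal_cpow (by linarith [hy.2])]
  push_cast
  rfl

theorem integrableOn_quarterWeight_mul_sqrt_pow (n : ℕ) :
    IntegrableOn (fun y => quarterWeight y * √y ^ n) (Ioo 0 1) := by
  have h := Complex.betaIntegral_convergent (u := ((n / 2 + 1 / 4 : ℝ) : ℂ))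
    (v := ((1 / 2 : ℝ) : ℂ)) (by rw [Complex.ofReal_re]; positivity)
    (by rw [Complex.ofReal_re]; positivity)
  rw [intervalIntegrable_iff_integrableOn_Ioo_of_le zero_le_one] at h
  have h2 := (h.congr_fun (fun y hy => (ofReal_quarterWeight_mul_sqrt_pow hy n).symm)
    measurableSet_Ioo).re
  exact h2

theorem integral_quarterWeight_mul_sqrt_pow (n : ℕ) :
    ∫ y in Ioo (0 : ℝ) 1, quarterWeight y * √y ^ n = quarterMoment n := by
  rw [quarterMoment, ProbabilityTheory.beta_eq_betaIntegralReal _ _ (by positivity) (by norm_num),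
    Complex.betaIntegral, intervalIntegral.integral_of_le zero_le_one, integral_Ioc_eq_integral_Ioo,
    ← setIntegral_congr_fun measurableSet_Ioo
      (fun y hy => ofReal_quarterWeight_mul_sqrt_pow hy n), integral_complex_ofReal,
    Complex.ofReal_re]

theorem quarterMoment_le_zero (n : ℕ) : quarterMoment n ≤ quarterMoment 0 := by
  rw [← integral_quarterWeight_mul_sqrt_pow, ← integral_quarterWeight_mul_sqrt_pow]
  refine setIntegral_mono_on (integrableOn_quarterWeight_mul_sqrt_pow n)
    (integrableOn_quarterWeight_mul_sqrt_pow 0) measurableSet_Ioo fun y hy => ?_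
  have h1 : 0 ≤ quarterWeight y :=
    mul_nonneg (Real.rpow_nonneg hy.1.le _) (Real.rpow_nonneg (by linarith [hy.2]) _)
  rw [pow_zero]
  exact mul_le_mul_of_nonneg_left
    (pow_le_one₀ (Real.sqrt_nonneg y) (Real.sqrt_le_one.mpr hy.2.le)) h1

/-- Two binomial steps and one moment step combine to the term ratio `(m + 1/4)² / ((m + 1/2)(m +
1))`: the factor `m + 3/4` cancels. In the odd case the ratio is `(m + 3/4)² / ((m + 3/2)(m + 1))`.
-/
theorem invSqrtCoeff_mul_quarterMoment_even (m : ℕ) :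
    ((invSqrtCoeff (2 * m) * quarterMoment (2 * m) : ℝ) : ℂ) = quarterMoment 0 *
      ((m.factorial : ℂ)⁻¹ * (ascPochhammer ℂ m).eval (1 / 4) * (ascPochhammer ℂ m).eval (1 / 4) *
        ((ascPochhammer ℂ m).eval (1 / 2))⁻¹) := by
  induction m with
  | zero => simp [invSqrtCoeff_zero]
  | succ m ih =>
    have h1 : invSqrtCoeff (2 * (m + 1)) * quarterMoment (2 * (m + 1)) =
        invSqrtCoeff (2 * m) * quarterMoment (2 * m) *
          ((m + 1 / 4) ^ 2 / ((m + 1 / 2) * (m + 1))) := by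
      rw [show 2 * (m + 1) = 2 * m + 1 + 1 by ring, invSqrtCoeff_succ, invSqrtCoeff_succ,
        quarterMoment_add_two]
      push_cast
      field_simp
      ring
    have h2 : ((m + 1 / 2 : ℝ) : ℂ) ≠ 0 := Complex.ofReal_ne_zero.mpr (by positivity)
    push_cast at h2
    rw [h1, Complex.ofReal_mul, ih, ascPochhammer_succ_eval, ascPochhammer_succ_eval,
      Nat.factorial_succ, mul_inv]
    push_cast
    rw [add_comm (1 / 2 : ℂ), mul_inv]
    field_simp
    ring

theorem invSqrtCoeff_mul_quarterMoment_odd (m : ℕ) :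
    ((invSqrtCoeff (2 * m + 1) * quarterMoment (2 * m + 1) : ℝ) : ℂ) = quarterMoment 1 / 2 *
      ((m.factorial : ℂ)⁻¹ * (ascPochhammer ℂ m).eval (3 / 4) * (ascPochhammer ℂ m).eval (3 / 4) *
        ((ascPochhammer ℂ m).eval (3 / 2))⁻¹) := by
  induction m with
  | zero => simp [invSqrtCoeff_zero, invSqrtCoeff_succ]; ring
  | succ m ih =>
    have h1 : invSqrtCoeff (2 * (m + 1) + 1) * quarterMoment (2 * (m + 1) + 1) =
        invSqrtCoeff (2 * m + 1) * quarterMoment (2 * m + 1) *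
          ((m + 3 / 4) ^ 2 / ((m + 3 / 2) * (m + 1))) := by
      rw [show 2 * (m + 1) + 1 = 2 * m + 1 + 1 + 1 by ring, invSqrtCoeff_succ (2 * m + 1 + 1),
        invSqrtCoeff_succ (2 * m + 1), quarterMoment_add_two]
      push_cast
      field_simp
      ring
    have h2 : ((m + 3 / 2 : ℝ) : ℂ) ≠ 0 := Complex.ofReal_ne_zero.mpr (by positivity)
    push_cast at h2
    rw [h1, Complex.ofReal_mul, ih, ascPochhammer_succ_eval, ascPochhammer_succ_eval,
      Nat.factorial_succ, mul_inv]
    push_cast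
    rw [add_comm (3 / 2 : ℂ), mul_inv]
    field_simp
    ring

/-! ### The centered elliptic integral: series expansion and sector bound -/

/-- `∫₀¹ y^(-3/4) (1 - y)^(-1/2) (1 + u √y)^(-1/2) dy`, a multiple of the complete elliptic integral
of parameter `(1 - u) / 2`. -/
noncomputable def centeredElliptic (u : ℂ) : ℂ :=
  ∫ y in Ioo (0 : ℝ) 1, (quarterWeight y : ℂ) * (1 + u * (√y : ℝ)) ^ (-1 / 2 : ℂ)

theorem norm_mul_sqrt_lt_one {u : ℂ} (hu : ‖u‖ < 1) {y : ℝ} (hy : y ∈ Ioo (0 : ℝ) 1) :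
    ‖u * (√y : ℝ)‖ < 1 := by
  rw [norm_mul, Complex.norm_real, Real.norm_of_nonneg (Real.sqrt_nonneg y)]
  exact (mul_le_of_le_one_right (norm_nonneg u) (Real.sqrt_le_one.mpr hy.2.le)).trans_lt hu

theorem quarterWeight_pos {y : ℝ} (hy : y ∈ Ioo (0 : ℝ) 1) : 0 < quarterWeight y :=
  mul_pos (Real.rpow_pos_of_pos hy.1 _) (Real.rpow_pos_of_pos (by linarith [hy.2]) _)

/-- Termwise integration of the binomial series; since the coefficients are at most 1 and the
moments at most the zeroth one, a geometric series dominates. -/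
theorem hasSum_centeredElliptic {u : ℂ} (hu : ‖u‖ < 1) :
    HasSum (fun n : ℕ => ((invSqrtCoeff n * quarterMoment n : ℝ) : ℂ) * (-u) ^ n)
      (centeredElliptic u) := by
  set F : ℕ → ℝ → ℂ := fun n y =>
    ((invSqrtCoeff n : ℂ) * (-u) ^ n) * ((quarterWeight y * √y ^ n : ℝ) : ℂ) with hF
  have hint : ∀ n, Integrable (F n) (volume.restrict (Ioo 0 1)) := fun n =>
    (integrableOn_quarterWeight_mul_sqrt_pow n).ofReal.const_mul _
  have hnorm : ∀ n, ∫ y in Ioo (0 : ℝ) 1, ‖F n y‖ = invSqrtCoeff n * ‖u‖ ^ n * quarterMoment n := by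
    intro n
    rw [← integral_quarterWeight_mul_sqrt_pow, ← integral_const_mul]
    refine setIntegral_congr_fun measurableSet_Ioo fun y hy => ?_
    simp only [hF]
    rw [norm_mul, norm_mul, norm_pow, norm_neg, Complex.norm_real, Complex.norm_real,
      Real.norm_of_nonneg (invSqrtCoeff_pos n).le, Real.norm_of_nonneg
        (mul_nonneg (quarterWeight_pos hy).le (by positivity))]
  have hsum : Summable fun n => ∫ y in Ioo (0 : ℝ) 1, ‖F n y‖ := by
    simp only [hnorm]
    refine Summable.of_nonneg_of_le (fun n => ?_) (fun n => ?_)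
      ((summable_geometric_of_lt_one (norm_nonneg u) hu).mul_right (quarterMoment 0))
    · have := (invSqrtCoeff_pos n).le
      have := (quarterMoment_pos n).le
      positivity
    · exact mul_le_mul (mul_le_of_le_one_left (by positivity) (invSqrtCoeff_le_one n))
        (quarterMoment_le_zero n) (quarterMoment_pos n).le (by positivity)
  have h := hasSum_integral_of_summable_integral_norm hint hsum
  have hval : ∫ y in Ioo (0 : ℝ) 1, ∑' n, F n y = centeredElliptic u := by
    refine setIntegral_congr_fun measurableSet_Ioo fun y hy => ?_
    rw [← (hasSum_one_add_cpow_neg_half (norm_mul_sqrt_lt_one hu hy)).tsum_eq, ← tsum_mul_left]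
    refine tsum_congr fun n => ?_
    simp only [hF]
    push_cast
    rw [← neg_mul, mul_pow]
    ring
  rw [hval] at h
  refine (congrArg (HasSum · _) (funext fun n => ?_)).mpr h
  rw [integral_const_mul, integral_complex_ofReal, integral_quarterWeight_mul_sqrt_pow]
  push_cast
  ring

theorem centeredElliptic_eq_hypergeometric {u : ℂ} (hu : ‖u‖ < 1) :
    centeredElliptic u = quarterMoment 0 * ordinaryHypergeometric (1 / 4 : ℂ) (1 / 4) (1 / 2) (u ^ 2)
      - quarterMoment 1 / 2 *
        (u * ordinaryHypergeometric (3 / 4 : ℂ) (3 / 4) (3 / 2) (u ^ 2)) := by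
  have h := hasSum_centeredElliptic hu
  set f : ℕ → ℂ := fun n => ((invSqrtCoeff n * quarterMoment n : ℝ) : ℂ) * (-u) ^ n with hf
  have he : Summable fun k => f (2 * k) :=
    h.summable.comp_injective (mul_right_injective₀ two_ne_zero)
  have ho : Summable fun k => f (2 * k + 1) :=
    h.summable.comp_injective fun a b hab => by simpa using hab
  rw [h.unique (HasSum.even_add_odd he.hasSum ho.hasSum), sub_eq_add_neg,
    ordinaryHypergeometric_eq_tsum, ordinaryHypergeometric_eq_tsum]
  simp only [smul_eq_mul]
  rw [← tsum_mul_left, ← tsum_mul_left, ← tsum_mul_left, ← tsum_neg]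
  congr 1 <;> refine tsum_congr fun n => ?_ <;> simp only [hf]
  · rw [invSqrtCoeff_mul_quarterMoment_even, pow_mul, neg_sq, mul_assoc]
  · rw [invSqrtCoeff_mul_quarterMoment_odd, pow_succ, pow_mul, neg_sq]
    ring

theorem centeredElliptic_ofReal {u : ℝ} (hu : |u| < 1) :
    centeredElliptic u = (2 * √2 * agmIntegral 1 √((1 + u) / 2) : ℝ) := by
  rw [← integral_quarterWeight_eq_agmIntegral (by linarith [neg_abs_le u]), ← integral_complex_ofReal]
  refine setIntegral_congr_fun measurableSet_Ioo fun y hy => ?_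
  have h := norm_mul_sqrt_lt_one (u := (u : ℂ)) (by simpa using hu) hy
  rw [← Complex.ofReal_mul, Complex.norm_real, Real.norm_eq_abs] at h
  rw [Complex.ofReal_mul, Complex.ofReal_cpow (by linarith [neg_abs_le (u * √y)])]
  push_cast
  rfl

/-- The power `-1/2` halves the argument up to sign, so the right half-plane goes into the sector
`|arg| < π/4`. -/
theorem abs_im_lt_re_cpow_neg_half {w : ℂ} (hw : 0 < w.re) :
    |(w ^ (-1 / 2 : ℂ)).im| < (w ^ (-1 / 2 : ℂ)).re := by
  have hw0 : w ≠ 0 := fun h => by simp [h] at hw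
  have harg := Complex.abs_arg_lt_pi_div_two_iff.mpr (Or.inl hw)
  have hφ := abs_lt.mp harg
  have e : (-1 / 2 : ℂ) = ((-1 / 2 : ℝ) : ℂ) := by push_cast; rfl
  rw [e, Complex.cpow_ofReal_re, Complex.cpow_ofReal_im, abs_mul,
    abs_of_pos (Real.rpow_pos_of_pos (norm_pos_iff.mpr hw0) _)]
  refine mul_lt_mul_of_pos_left ?_ (Real.rpow_pos_of_pos (norm_pos_iff.mpr hw0) _)
  have hc : 0 < Real.cos (w.arg * (-1 / 2)) :=
    Real.cos_pos_of_mem_Ioo ⟨by linarith [Real.pi_pos], by linarith [Real.pi_pos]⟩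
  refine abs_lt_of_sq_lt_sq ?_ hc.le
  have hc2 : 0 < Real.cos (2 * (w.arg * (-1 / 2))) :=
    Real.cos_pos_of_mem_Ioo ⟨by linarith, by linarith⟩
  rw [Real.cos_two_mul'] at hc2
  linarith

theorem integrableOn_centeredElliptic {u : ℂ} (hu : ‖u‖ < 1) :
    IntegrableOn (fun y : ℝ => (quarterWeight y : ℂ) * (1 + u * (√y : ℝ)) ^ (-1 / 2 : ℂ))
      (Ioo 0 1) := by
  have h0 : IntegrableOn quarterWeight (Ioo 0 1) := by
    simpa using integrableOn_quarterWeight_mul_sqrt_pow 0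
  refine Integrable.mul_bdd (c := ∑' n : ℕ, ‖u‖ ^ n) h0.ofReal
    (Measurable.aestronglyMeasurable (by fun_prop)) ?_
  refine (ae_restrict_iff' measurableSet_Ioo).mpr (Eventually.of_forall fun y hy => ?_)
  rw [← (hasSum_one_add_cpow_neg_half (norm_mul_sqrt_lt_one hu hy)).tsum_eq]
  refine tsum_of_norm_bounded (summable_geometric_of_lt_one (norm_nonneg u) hu).hasSum fun n => ?_
  rw [norm_mul, norm_pow, norm_neg, Complex.norm_real, Real.norm_of_nonneg (invSqrtCoeff_pos n).le,
    norm_mul, Complex.norm_real, Real.norm_of_nonneg (Real.sqrt_nonneg y)]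
  refine (mul_le_of_le_one_left (by positivity) (invSqrtCoeff_le_one n)).trans ?_
  refine pow_le_pow_left₀ (by positivity) ?_ n
  exact mul_le_of_le_one_right (norm_nonneg u) (Real.sqrt_le_one.mpr hy.2.le)

/-- The sector `|Im| < Re` is a convex cone containing every value of the integrand, since the
weight is positive and `1 + u√y` has positive real part. -/
theorem abs_im_lt_re_centeredElliptic {u : ℂ} (hu : ‖u‖ < 1) :
    |(centeredElliptic u).im| < (centeredElliptic u).re := by
  have hint := integrableOn_centeredElliptic hu
  have hre : (centeredElliptic u).re = ∫ y in Ioo (0 : ℝ) 1,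
      ((quarterWeight y : ℂ) * (1 + u * (√y : ℝ)) ^ (-1 / 2 : ℂ)).re := (integral_re hint).symm
  have him : (centeredElliptic u).im = ∫ y in Ioo (0 : ℝ) 1,
      ((quarterWeight y : ℂ) * (1 + u * (√y : ℝ)) ^ (-1 / 2 : ℂ)).im := (integral_im hint).symm
  have hire : IntegrableOn (fun y : ℝ =>
      ((quarterWeight y : ℂ) * (1 + u * (√y : ℝ)) ^ (-1 / 2 : ℂ)).re) (Ioo 0 1) := hint.re
  have hiim : IntegrableOn (fun y : ℝ =>
      ((quarterWeight y : ℂ) * (1 + u * (√y : ℝ)) ^ (-1 / 2 : ℂ)).im) (Ioo 0 1) := hint.im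
  have hpt : ∀ y ∈ Ioo (0 : ℝ) 1,
      |((quarterWeight y : ℂ) * (1 + u * (√y : ℝ)) ^ (-1 / 2 : ℂ)).im| <
      ((quarterWeight y : ℂ) * (1 + u * (√y : ℝ)) ^ (-1 / 2 : ℂ)).re := by
    intro y hy
    rw [Complex.re_ofReal_mul, Complex.im_ofReal_mul, abs_mul, abs_of_pos (quarterWeight_pos hy)]
    refine mul_lt_mul_of_pos_left (abs_im_lt_re_cpow_neg_half ?_) (quarterWeight_pos hy)
    have h := norm_mul_sqrt_lt_one hu hy
    have h2 := Complex.abs_re_le_norm (u * (√y : ℝ))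
    rw [Complex.add_re, Complex.one_re]
    linarith [neg_abs_le (u * (√y : ℝ)).re]
  have hpos : 0 < ∫ y in Ioo (0 : ℝ) 1,
      (((quarterWeight y : ℂ) * (1 + u * (√y : ℝ)) ^ (-1 / 2 : ℂ)).re -
      |((quarterWeight y : ℂ) * (1 + u * (√y : ℝ)) ^ (-1 / 2 : ℂ)).im|) := by
    rw [setIntegral_pos_iff_support_of_nonneg_ae]
    · have : (Function.support fun y : ℝ =>
          (((quarterWeight y : ℂ) * (1 + u * (√y : ℝ)) ^ (-1 / 2 : ℂ)).re -
          |((quarterWeight y : ℂ) * (1 + u * (√y : ℝ)) ^ (-1 / 2 : ℂ)).im|)) ∩ Ioo 0 1 = Ioo 0 1 :=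
        inter_eq_right.mpr fun y hy => (sub_pos.mpr (hpt y hy)).ne'
      rw [this]
      simp
    · exact (ae_restrict_iff' measurableSet_Ioo).mpr
        (Eventually.of_forall fun y hy => (sub_pos.mpr (hpt y hy)).le)
    · exact hire.sub hiim.abs
  rw [integral_sub hire hiim.abs, ← hre] at hpos
  rw [him]
  exact (abs_integral_le_integral_abs).trans_lt (by linarith)

/-! ### Power series: radius, coefficients and holomorphy -/

theorem le_radius_ofScalars_of_summable {c : ℕ → ℂ} {z : ℂ}
    (h : Summable fun n => c n * z ^ n) :
    (‖z‖₊ : ENNReal) ≤ (FormalMultilinearSeries.ofScalars ℂ c).radius := by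
  refine FormalMultilinearSeries.le_radius_of_summable _ (h.norm.congr fun n => ?_)
  rw [FormalMultilinearSeries.ofScalars_norm, norm_mul, norm_pow, coe_nnnorm]

theorem hasFPowerSeriesOnBall_tsum {c : ℕ → ℂ} {z : ℂ} (hz : z ≠ 0)
    (h : Summable fun n => c n * z ^ n) :
    HasFPowerSeriesOnBall (fun s => ∑' n, c n * s ^ n) (FormalMultilinearSeries.ofScalars ℂ c) 0
      ‖z‖₊ := by
  have hr := le_radius_ofScalars_of_summable h
  have hpos : (0 : ENNReal) < ‖z‖₊ := by simpa using hz
  refine (((FormalMultilinearSeries.ofScalars ℂ c).hasFPowerSeriesOnBall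
    (hpos.trans_le hr)).mono hpos hr).congr fun s _ => ?_
  simp [FormalMultilinearSeries.sum, mul_comm]

/-- Two power series that converge to the same value at points accumulating at `0` have the same
coefficients. -/
theorem powerSeries_coeff_eq_of_frequently {a b : ℕ → ℂ}
    (h : ∃ᶠ s in 𝓝[≠] (0 : ℂ), ∃ S, HasSum (fun n => a n * s ^ n) S ∧
      HasSum (fun n => b n * s ^ n) S) : a = b := by
  have h0 : ∃ᶠ s in 𝓝[≠] (0 : ℂ), HasSum (fun n => (a - b) n * s ^ n) 0 := by
    refine h.mono fun s hs => ?_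
    obtain ⟨S, ha, hb⟩ := hs
    simpa [sub_mul] using ha.sub hb
  -- Convergence at a single nonzero point already gives a positive radius.
  obtain ⟨z, hz, hz0⟩ := (h0.and_eventually self_mem_nhdsWithin).exists
  have hps := (hasFPowerSeriesOnBall_tsum hz0 hz.summable).hasFPowerSeriesAt
  have hev := hps.analyticAt.frequently_zero_iff_eventually_zero.mp
    (h0.mono fun s hs => hs.tsum_eq)
  have hp := (hps.congr hev).eq_zero
  exact sub_eq_zero.mp (FormalMultilinearSeries.ofScalars_series_eq_zero (E := ℂ).mp hp)

theorem differentiableOn_tsum_of_summable {c : ℕ → ℂ} {R : ℝ}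
    (h : ∀ z : ℂ, ‖z‖ < R → Summable fun n => c n * z ^ n) :
    DifferentiableOn ℂ (fun s => ∑' n, c n * s ^ n) (Metric.ball 0 R) := by
  intro s hs
  rw [mem_ball_zero_iff] at hs
  obtain ⟨r, hr1, hr2⟩ := exists_between hs
  have hr0 : 0 < r := (norm_nonneg s).trans_lt hr1
  have hrn : ‖(r : ℂ)‖ = r := by rw [Complex.norm_real, Real.norm_of_nonneg hr0.le]
  have hp := hasFPowerSeriesOnBall_tsum (z := (r : ℂ)) (by exact_mod_cast hr0.ne')
    (h r (by rwa [hrn]))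
  refine (hp.analyticAt_of_mem ?_).differentiableAt.differentiableWithinAt
  rw [mem_eball_zero_iff, enorm_eq_nnnorm, ENNReal.coe_lt_coe, ← NNReal.coe_lt_coe, coe_nnnorm,
    coe_nnnorm, hrn]
  exact hr1

theorem differentiableOn_ordinaryHypergeometric {a b c : ℂ}
    (h : ∀ k : ℕ, (k : ℂ) ≠ -a ∧ (k : ℂ) ≠ -b ∧ (k : ℂ) ≠ -c) :
    DifferentiableOn ℂ (ordinaryHypergeometric a b c : ℂ → ℂ) (Metric.ball 0 1) := by
  have hr := ordinaryHypergeometricSeries_radius_eq_one (𝔸 := ℂ) a b c h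
  have hp := (ordinaryHypergeometricSeries ℂ a b c).hasFPowerSeriesOnBall (by rw [hr]; simp)
  rw [hr] at hp
  have := hp.differentiableOn
  rwa [← ENNReal.ofReal_one, Metric.eball_ofReal] at this

theorem natCast_ne_neg_ofReal {a : ℝ} (ha : 0 < a) (k : ℕ) : (k : ℂ) ≠ -(a : ℂ) := by
  intro h
  have := congrArg Complex.re h
  simp only [Complex.natCast_re, Complex.neg_re, Complex.ofReal_re] at this
  linarith [k.cast_nonneg (α := ℝ)]

theorem differentiableOn_hypergeometric_of_pos {a b c : ℝ} (ha : 0 < a) (hb : 0 < b) (hc : 0 < c) :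
    DifferentiableOn ℂ (ordinaryHypergeometric (a : ℂ) (b : ℂ) (c : ℂ) : ℂ → ℂ)
      (Metric.ball 0 1) :=
  differentiableOn_ordinaryHypergeometric fun k =>
    ⟨natCast_ne_neg_ofReal ha k, natCast_ne_neg_ofReal hb k, natCast_ne_neg_ofReal hc k⟩

/-! ### The constant `Φ` and the mapping properties of `U` and `V` -/

theorem thetaPhi_eq : thetaPhi = quarterMoment 0 ^ 2 / (2 * quarterMoment 1 ^ 2) := by
  unfold thetaPhi quarterMoment ProbabilityTheory.beta
  have h1 : Real.Gamma (5 / 4) = Real.Gamma (1 / 4) / 4 := by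
    rw [show (5 / 4 : ℝ) = 1 / 4 + 1 by norm_num, Real.Gamma_add_one (by norm_num)]
    ring
  have h2 : Real.Gamma (3 / 4) = Real.pi * √2 / Real.Gamma (1 / 4) := by
    have h := Real.Gamma_mul_Gamma_one_sub (1 / 4)
    rw [show Real.pi * (1 / 4) = Real.pi / 4 by ring, Real.sin_pi_div_four] at h
    have hG : Real.Gamma (1 / 4) ≠ 0 := (Real.Gamma_pos_of_pos (by norm_num)).ne'
    rw [eq_div_iff hG, mul_comm, show (3 / 4 : ℝ) = 1 - 1 / 4 by norm_num, h,
      div_eq_iff (by positivity)]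
    have : √(2 : ℝ) * √2 = 2 := Real.mul_self_sqrt (by norm_num)
    linear_combination (-Real.pi / 2) * this
  norm_num
  rw [h1, h2]
  have hG : 0 < Real.Gamma (1 / 4) := Real.Gamma_pos_of_pos (by norm_num)
  have h4 : √(2 : ℝ) ^ 4 = 4 := by
    rw [show 4 = 2 * 2 by norm_num, pow_mul, Real.sq_sqrt (by norm_num)]
    norm_num
  have hH : 0 < Real.Gamma (1 / 2) := Real.Gamma_pos_of_pos (by norm_num)
  have hpi := Real.pi_pos
  field_simp
  rw [h4]
  norm_num

theorem thetaPhi_pos : 0 < thetaPhi := by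
  rw [thetaPhi_eq]
  have := quarterMoment_pos 0
  have := quarterMoment_pos 1
  positivity

theorem centeredElliptic_add_neg {u : ℂ} (hu : ‖u‖ < 1) :
    centeredElliptic u + centeredElliptic (-u) =
      2 * quarterMoment 0 * ordinaryHypergeometric (1 / 4 : ℂ) (1 / 4) (1 / 2) (u ^ 2) := by
  rw [centeredElliptic_eq_hypergeometric hu,
    centeredElliptic_eq_hypergeometric (by rwa [norm_neg]), neg_sq]
  ring

theorem centeredElliptic_neg_sub {u : ℂ} (hu : ‖u‖ < 1) :
    centeredElliptic (-u) - centeredElliptic u =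
      quarterMoment 1 * (u * ordinaryHypergeometric (3 / 4 : ℂ) (3 / 4) (3 / 2) (u ^ 2)) := by
  rw [centeredElliptic_eq_hypergeometric hu,
    centeredElliptic_eq_hypergeometric (by rwa [norm_neg]), neg_sq]
  ring

theorem exists_sq_eq_norm_lt_one {v : ℂ} (hv : ‖v‖ < 1) : ∃ u : ℂ, ‖u‖ < 1 ∧ u ^ 2 = v := by
  obtain ⟨u, rfl⟩ := IsAlgClosed.exists_pow_nat_eq v two_pos
  rw [norm_pow] at hv
  exact ⟨u, (pow_lt_one_iff_of_nonneg (norm_nonneg u) two_ne_zero).mp hv, rfl⟩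

/-- It is a positive multiple of `C(u) + C(-u)` with `u² = v`. This makes the denominator of `U`
zero-free and the principal root in `V` holomorphic. -/
theorem re_hypergeometric_quarter_pos {v : ℂ} (hv : ‖v‖ < 1) :
    0 < (ordinaryHypergeometric (1 / 4 : ℂ) (1 / 4) (1 / 2) v).re := by
  obtain ⟨u, hu, rfl⟩ := exists_sq_eq_norm_lt_one hv
  have h1 := abs_im_lt_re_centeredElliptic hu
  have h2 := abs_im_lt_re_centeredElliptic (u := -u) (by rwa [norm_neg])
  have h := congrArg Complex.re (centeredElliptic_add_neg hu)
  rw [Complex.add_re, mul_assoc, ← Complex.ofReal_ofNat 2, Complex.re_ofReal_mul,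
    Complex.re_ofReal_mul, Complex.ofReal_ofNat, ← mul_assoc] at h
  have h3 : 0 < 2 * quarterMoment 0 *
      (ordinaryHypergeometric (1 / 4 : ℂ) (1 / 4) (1 / 2) (u ^ 2)).re := by
    rw [← h]
    linarith [abs_nonneg (centeredElliptic u).im, abs_nonneg (centeredElliptic (-u)).im]
  exact pos_of_mul_pos_right h3 (by linarith [quarterMoment_pos 0])

theorem norm_sub_lt_norm_add_of_abs_im_lt_re {z w : ℂ} (hz : |z.im| < z.re) (hw : |w.im| < w.re) :
    ‖z - w‖ < ‖w + z‖ := by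
  refine lt_of_pow_lt_pow_left₀ 2 (norm_nonneg _) ?_
  rw [Complex.sq_norm, Complex.sq_norm, Complex.normSq_apply, Complex.normSq_apply]
  simp only [Complex.sub_re, Complex.sub_im, Complex.add_re, Complex.add_im]
  have h : |z.im * w.im| < z.re * w.re := by
    rw [abs_mul]
    exact mul_lt_mul'' hz hw (abs_nonneg _) (abs_nonneg _)
  nlinarith [neg_abs_le (z.im * w.im)]

/-- Two points of the sector `|arg| < π/4` have an angle below `π/2` between them, so `|C(-u) -
C(u)| < |C(u) + C(-u)|`. Squaring this with `u² = 4t` gives the bound, which keeps `t U(t)²` inside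
the disc of convergence of the `d(n)` series. -/
theorem norm_mul_genU_sq_lt {t : ℂ} (ht : ‖t‖ < 1 / 4) : ‖t * genU t ^ 2‖ < 2 * thetaPhi := by
  have hv : ‖4 * t‖ < 1 := by
    rw [norm_mul, Complex.norm_ofNat]
    linarith
  have hF := re_hypergeometric_quarter_pos hv
  obtain ⟨u, hu, huv⟩ := exists_sq_eq_norm_lt_one hv
  have h := norm_sub_lt_norm_add_of_abs_im_lt_re (abs_im_lt_re_centeredElliptic (u := -u)
    (by rwa [norm_neg])) (abs_im_lt_re_centeredElliptic hu)
  rw [centeredElliptic_add_neg hu, centeredElliptic_neg_sub hu, huv] at h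
  have hF0 : ordinaryHypergeometric (1 / 4 : ℂ) (1 / 4) (1 / 2) (4 * t) ≠ 0 :=
    fun h => by rw [h] at hF; exact lt_irrefl _ hF
  unfold genU
  set F := ordinaryHypergeometric (1 / 4 : ℂ) (1 / 4) (1 / 2) (4 * t)
  set G := ordinaryHypergeometric (3 / 4 : ℂ) (3 / 4) (3 / 2) (4 * t)
  have hB0 := quarterMoment_pos 0
  have hB1 := quarterMoment_pos 1
  have hFn : 0 < ‖F‖ := norm_pos_iff.mpr hF0
  have h2 := pow_lt_pow_left₀ h (norm_nonneg _) two_ne_zero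
  simp only [norm_mul, Complex.norm_real, Real.norm_of_nonneg hB0.le, Real.norm_of_nonneg hB1.le,
    Complex.norm_ofNat, mul_pow] at h2
  rw [← norm_pow u, huv, norm_mul, Complex.norm_ofNat] at h2
  rw [thetaPhi_eq, norm_mul, norm_pow, norm_div, div_pow, mul_div_assoc', mul_div_assoc',
    div_lt_div_iff₀ (by positivity) (by positivity)]
  nlinarith

theorem differentiableOn_genU : DifferentiableOn ℂ genU (Metric.ball 0 (1 / 4)) := by
  have hmaps : MapsTo (fun t : ℂ => 4 * t) (Metric.ball 0 (1 / 4)) (Metric.ball 0 1) := by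
    intro t ht
    rw [mem_ball_zero_iff] at ht ⊢
    rw [norm_mul, Complex.norm_ofNat]
    linarith
  have h1 := differentiableOn_hypergeometric_of_pos (a := 3 / 4) (b := 3 / 4) (c := 3 / 2)
    (by norm_num) (by norm_num) (by norm_num)
  have h2 := differentiableOn_hypergeometric_of_pos (a := 1 / 4) (b := 1 / 4) (c := 1 / 2)
    (by norm_num) (by norm_num) (by norm_num)
  push_cast at h1 h2
  refine (h1.comp (by fun_prop) hmaps).div (h2.comp (by fun_prop) hmaps) fun t ht h => ?_
  have := re_hypergeometric_quarter_pos (mem_ball_zero_iff.mp (hmaps ht))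
  rw [show ordinaryHypergeometric (1 / 4 : ℂ) (1 / 4) (1 / 2) (4 * t) = 0 from h] at this
  exact lt_irrefl _ this

theorem differentiableOn_genV : DifferentiableOn ℂ genV (Metric.ball 0 (1 / 4)) := by
  have hmaps : MapsTo (fun t : ℂ => 4 * t) (Metric.ball 0 (1 / 4)) (Metric.ball 0 1) := by
    intro t ht
    rw [mem_ball_zero_iff] at ht ⊢
    rw [norm_mul, Complex.norm_ofNat]
    linarith
  have h2 := differentiableOn_hypergeometric_of_pos (a := 1 / 4) (b := 1 / 4) (c := 1 / 2)
    (by norm_num) (by norm_num) (by norm_num)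
  push_cast at h2
  exact (h2.comp (by fun_prop) hmaps).cpow_const fun t ht =>
    Or.inl (re_hypergeometric_quarter_pos (mem_ball_zero_iff.mp (hmaps ht)))

theorem genU_zero : genU 0 = 1 := by simp [genU]

/-! ### The Taylor expansion of `σ₃` -/

theorem re_one_sub_div_one_add_pos {z : ℂ} (hz : ‖z‖ < 1) : 0 < ((1 - z) / (1 + z)).re := by
  have h1 : 1 + z ≠ 0 := by
    intro h
    rw [← neg_eq_iff_add_eq_zero] at h
    rw [← h] at hz
    simp at hz
  have h2 : z.re ^ 2 + z.im ^ 2 < 1 := by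
    have := pow_lt_one₀ (norm_nonneg z) hz two_ne_zero
    rw [Complex.sq_norm, Complex.normSq_apply] at this
    linarith
  rw [Complex.div_re, ← add_div]
  refine div_pos ?_ (Complex.normSq_pos.mpr h1)
  simp
  nlinarith

theorem differentiableOn_sigmaThree : DifferentiableOn ℂ sigmaThree (Metric.ball 0 1) := by
  intro z hz
  rw [mem_ball_zero_iff] at hz
  have hre : 0 < (1 + z).re := by
    have := Complex.abs_re_le_norm z
    rw [Complex.add_re, Complex.one_re]
    linarith [neg_abs_le z.re]
  have h1 : 1 + z ≠ 0 := fun h => by simp [h] at hre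
  refine DifferentiableAt.differentiableWithinAt ?_
  unfold sigmaThree
  have hc : DifferentiableAt ℂ (fun z : ℂ => (1 + z) ^ (1 / 2 : ℂ)) z :=
    DifferentiableAt.cpow_const (by fun_prop) (Or.inl hre)
  have hd : DifferentiableAt ℂ (fun z : ℂ => (1 - z) / (1 + z)) z :=
    DifferentiableAt.div (by fun_prop) (by fun_prop) h1
  refine DifferentiableAt.mul ((differentiableAt_const _).div hc ?_) ?_
  · simp [Complex.cpow_eq_zero_iff, h1]
  · exact DifferentiableAt.comp z (differentiableAt_thetaThree (re_one_sub_div_one_add_pos hz)) hd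

theorem sigmaThree_ofReal {x : ℝ} (hx : 0 < x) :
    sigmaThree (((1 - x) / (1 + x) : ℝ) : ℂ) = (√((1 + x) / 2) * realThetaThree x : ℝ) := by
  have h1 : (1 + (((1 - x) / (1 + x) : ℝ) : ℂ)) = ((((1 + x) / 2)⁻¹ : ℝ) : ℂ) := by
    rw [← Complex.ofReal_one, ← Complex.ofReal_add]
    congr 1
    field_simp
    ring
  have h2 : (1 - (((1 - x) / (1 + x) : ℝ) : ℂ)) / (1 + (((1 - x) / (1 + x) : ℝ) : ℂ)) = (x : ℂ) := by
    rw [h1, ← Complex.ofReal_one, ← Complex.ofReal_sub, ← Complex.ofReal_div]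
    congr 1
    field_simp
    ring
  have h3 : (((((1 + x) / 2)⁻¹ : ℝ) : ℂ)) ^ (1 / 2 : ℂ) = ((√((1 + x) / 2))⁻¹ : ℝ) := by
    rw [← Real.sqrt_inv, Real.sqrt_eq_rpow, Complex.ofReal_cpow (by positivity)]
    norm_num
  rw [sigmaThree, h2, h1, h3, thetaThree_ofReal]
  push_cast
  rw [one_div, inv_inv]

/-- Under `z = (1 - x)/(1 + x)`, the inversion `x ↦ 1/x` becomes `z ↦ -z`, and the square-root
prefactor absorbs the `√x` of the inversion formula. -/
theorem sigmaThree_neg_ofReal {x : ℝ} (hx : 0 < x) :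
    sigmaThree (-(((1 - x) / (1 + x) : ℝ) : ℂ)) = sigmaThree (((1 - x) / (1 + x) : ℝ) : ℂ) := by
  have h : -(((1 - x) / (1 + x) : ℝ) : ℂ) = (((1 - x⁻¹) / (1 + x⁻¹) : ℝ) : ℂ) := by
    rw [← Complex.ofReal_neg]
    congr 1
    field_simp
    ring
  rw [h, sigmaThree_ofReal (inv_pos.mpr hx), sigmaThree_ofReal hx, realThetaThree_inv hx,
    ← mul_assoc, ← Real.sqrt_mul (by positivity),
    show (1 + x⁻¹) / 2 * x = (1 + x) / 2 by field_simp; ring]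

theorem exists_pos_eq_one_sub_div {z : ℝ} (hz : |z| < 1) :
    ∃ x : ℝ, 0 < x ∧ (1 - x) / (1 + x) = z := by
  obtain ⟨h1, h2⟩ := abs_lt.mp hz
  have h3 : 0 < 1 + z := by linarith
  refine ⟨(1 - z) / (1 + z), div_pos (by linarith) h3, ?_⟩
  field_simp
  ring

theorem hasSum_sigmaThree {z : ℂ} (hz : ‖z‖ < 1) :
    HasSum (fun n : ℕ => iteratedDeriv n sigmaThree 0 / (n.factorial : ℂ) * z ^ n)
      (sigmaThree z) := by
  have h := Complex.hasSum_taylorSeries_on_ball (c := 0) (r := 1) differentiableOn_sigmaThree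
    (mem_ball_zero_iff.mpr hz)
  refine (congrArg (HasSum · _) (funext fun n => ?_)).mpr h
  rw [sub_zero, smul_eq_mul, smul_eq_mul]
  ring

theorem frequently_real_nhdsWithin_zero {p : ℂ → Prop} (h : ∀ z : ℝ, |z| < 1 → p z) :
    ∃ᶠ s in 𝓝[≠] (0 : ℂ), p s := by
  have ht : Tendsto (fun z : ℝ => (z : ℂ)) (𝓝[≠] 0) (𝓝[≠] 0) := by
    refine tendsto_nhdsWithin_iff.mpr ⟨?_, ?_⟩
    · exact (Complex.continuous_ofReal.tendsto' 0 0 Complex.ofReal_zero).mono_left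
        nhdsWithin_le_nhds
    · filter_upwards [self_mem_nhdsWithin] with z hz using Complex.ofReal_ne_zero.mpr hz
  refine ht.frequently (Eventually.frequently ?_)
  filter_upwards [nhdsWithin_le_nhds (Metric.ball_mem_nhds (0 : ℝ) one_pos)] with z hz
  exact h z (by simpa using hz)

theorem iteratedDeriv_sigmaThree_odd {n : ℕ} (hn : Odd n) : iteratedDeriv n sigmaThree 0 = 0 := by
  have h : (fun n : ℕ => iteratedDeriv n sigmaThree 0 / (n.factorial : ℂ)) =
      fun n : ℕ => iteratedDeriv n sigmaThree 0 / (n.factorial : ℂ) * (-1) ^ n := by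
    refine powerSeries_coeff_eq_of_frequently (frequently_real_nhdsWithin_zero fun z hz => ?_)
    have hz' : ‖(z : ℂ)‖ < 1 := by simpa using hz
    refine ⟨sigmaThree z, hasSum_sigmaThree hz', ?_⟩
    have h2 := hasSum_sigmaThree (z := -z) (by rwa [norm_neg])
    obtain ⟨x, hx, rfl⟩ := exists_pos_eq_one_sub_div hz
    rw [sigmaThree_neg_ofReal hx] at h2
    refine (congrArg (HasSum · _) (funext fun n => ?_)).mpr h2
    rw [mul_assoc, ← mul_pow, neg_one_mul]
  have h1 := congrFun h n
  simp only [hn.neg_one_pow, mul_neg_one] at h1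
  have h2 := self_eq_neg.mp h1
  exact (div_eq_zero_iff.mp h2).resolve_right (by exact_mod_cast n.factorial_ne_zero)

theorem conj_iteratedDeriv_sigmaThree (n : ℕ) :
    (starRingEnd ℂ) (iteratedDeriv n sigmaThree 0) = iteratedDeriv n sigmaThree 0 := by
  have h : (fun n : ℕ => (starRingEnd ℂ) (iteratedDeriv n sigmaThree 0) / (n.factorial : ℂ)) =
      fun n : ℕ => iteratedDeriv n sigmaThree 0 / (n.factorial : ℂ) := by
    refine powerSeries_coeff_eq_of_frequently (frequently_real_nhdsWithin_zero fun z hz => ?_)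
    have h2 := hasSum_sigmaThree (z := z) (by simpa using hz)
    refine ⟨sigmaThree z, ?_, h2⟩
    have h3 := h2.mapL (Complex.conjCLE : ℂ →L[ℝ] ℂ)
    obtain ⟨x, hx, rfl⟩ := exists_pos_eq_one_sub_div hz
    rw [sigmaThree_ofReal hx] at h3 ⊢
    simpa only [ContinuousLinearEquiv.coe_coe, Complex.conjCLE_apply, map_mul, map_div₀, map_pow,
      Complex.conj_ofReal, map_natCast] using h3
  have h1 := congrFun h n
  exact (div_left_inj' (by exact_mod_cast n.factorial_ne_zero)).mp h1

theorem thetaThree_one_eq : thetaThree 1 = (realThetaThree 1 : ℂ) := by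
  rw [← thetaThree_ofReal, Complex.ofReal_one]

theorem thetaThree_one_ne_zero : thetaThree 1 ≠ 0 := by
  rw [thetaThree_one_eq]
  exact Complex.ofReal_ne_zero.mpr (realThetaThree_pos one_pos).ne'

theorem iteratedDeriv_sigmaThree_even (n : ℕ) :
    iteratedDeriv (2 * n) sigmaThree 0 = thetaThree 1 * (dCoeff n * (thetaPhi : ℂ) ^ n) := by
  have hP : (thetaPhi : ℂ) ^ n ≠ 0 :=
    pow_ne_zero _ (Complex.ofReal_ne_zero.mpr thetaPhi_pos.ne')
  have h : (dCoeff n : ℂ) =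
      iteratedDeriv (2 * n) sigmaThree 0 / (thetaThree 1 * (thetaPhi : ℂ) ^ n) := by
    -- Taking the real part in `dCoeff` loses nothing: the derivatives, `θ₃(1)` and `Φ` are fixed by
    -- conjugation.
    refine Complex.conj_eq_iff_re.mp ?_
    rw [map_div₀, conj_iteratedDeriv_sigmaThree, map_mul, map_pow, Complex.conj_ofReal,
      thetaThree_one_eq, Complex.conj_ofReal]
  have := thetaThree_one_ne_zero
  rw [h]
  field_simp

theorem hasSum_dCoeff_sigmaThree {z : ℂ} (hz : ‖z‖ < 1) :
    HasSum (fun n : ℕ => thetaThree 1 *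
      ((dCoeff n : ℂ) / (Nat.factorial (2 * n) : ℂ) * (thetaPhi : ℂ) ^ n * z ^ (2 * n)))
      (sigmaThree z) := by
  have hinj : Function.Injective fun n : ℕ => 2 * n := mul_right_injective₀ two_ne_zero
  have h := (hinj.hasSum_iff fun n hn => ?_).mpr (hasSum_sigmaThree hz)
  · refine (congrArg (HasSum · _) (funext fun n => ?_)).mpr h
    simp only [Function.comp_apply, iteratedDeriv_sigmaThree_even]
    ring
  · have hodd : Odd n := by
      rw [← Nat.not_even_iff_odd, even_iff_exists_two_mul]
      rintro ⟨k, rfl⟩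
      exact hn ⟨k, rfl⟩
    rw [iteratedDeriv_sigmaThree_odd hodd, zero_div, zero_mul]

theorem hasSum_dCoeff_of_sq_eq {z s : ℂ} (hz : ‖z‖ < 1) (hs : s = 2 * thetaPhi * z ^ 2) :
    HasSum (fun n : ℕ => (dCoeff n : ℂ) / (2 ^ n * (Nat.factorial (2 * n) : ℂ)) * s ^ n)
      (sigmaThree z / thetaThree 1) := by
  have h := (hasSum_dCoeff_sigmaThree hz).div_const (thetaThree 1)
  refine (congrArg (HasSum · _) (funext fun n => ?_)).mpr h
  have h1 := thetaThree_one_ne_zero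
  have h2 : ((2 * n).factorial : ℂ) ≠ 0 := by exact_mod_cast (2 * n).factorial_ne_zero
  rw [hs, mul_pow, mul_pow, ← pow_mul]
  field_simp

theorem summable_dCoeff {s : ℂ} (hs : ‖s‖ < 2 * thetaPhi) :
    Summable fun n : ℕ => (dCoeff n : ℂ) / (2 ^ n * (Nat.factorial (2 * n) : ℂ)) * s ^ n := by
  have hP := thetaPhi_pos
  have hP' : (thetaPhi : ℂ) ≠ 0 := Complex.ofReal_ne_zero.mpr hP.ne'
  obtain ⟨z, hz, hzs⟩ := exists_sq_eq_norm_lt_one (v := s / (2 * thetaPhi)) (by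
    rw [norm_div, norm_mul, Complex.norm_ofNat, Complex.norm_real, Real.norm_of_nonneg hP.le,
      div_lt_one (by positivity)]
    exact hs)
  refine (hasSum_dCoeff_of_sq_eq hz (s := s) ?_).summable
  rw [hzs]
  field_simp

/-! ### Parametrization by theta constants -/

/-- The parameter `1 - 2 λ` attached to `x`, where `λ = θ₂⁴ / θ₃⁴`. -/
noncomputable def centeredLambda (x : ℝ) : ℝ :=
  1 - 2 * (realThetaTwo x ^ 4 / realThetaThree x ^ 4)

theorem centeredLambda_eq {x : ℝ} (hx : 0 < x) :
    centeredLambda x = 2 * (realThetaFour x ^ 4 / realThetaThree x ^ 4) - 1 := by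
  have h3 := realThetaThree_pos hx
  have h := realThetaThree_pow_four hx
  unfold centeredLambda
  field_simp
  linarith

theorem abs_centeredLambda_lt_one {x : ℝ} (hx : 0 < x) : |centeredLambda x| < 1 := by
  have h2 := realThetaTwo_pos hx
  have h3 := realThetaThree_pos hx
  have h4 := realThetaFour_pos hx
  refine abs_lt.mpr ⟨?_, ?_⟩
  · rw [centeredLambda_eq hx]
    have : 0 < realThetaFour x ^ 4 / realThetaThree x ^ 4 := by positivity
    linarith
  · unfold centeredLambda
    have : 0 < realThetaTwo x ^ 4 / realThetaThree x ^ 4 := by positivity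
    linarith

theorem centeredElliptic_centeredLambda {x : ℝ} (hx : 0 < x) :
    centeredElliptic (centeredLambda x) = (√2 * Real.pi * realThetaThree x ^ 2 : ℝ) := by
  rw [centeredElliptic_ofReal (abs_centeredLambda_lt_one hx), centeredLambda_eq hx,
    show (1 + (2 * (realThetaFour x ^ 4 / realThetaThree x ^ 4) - 1)) / 2 =
      (realThetaFour x ^ 2 / realThetaThree x ^ 2) ^ 2 by ring, Real.sqrt_sq (by positivity),
    agmIntegral_one_theta_ratio hx]
  congr 1
  ring

theorem centeredElliptic_neg_centeredLambda {x : ℝ} (hx : 0 < x) :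
    centeredElliptic (-(centeredLambda x : ℂ)) =
      (√2 * Real.pi * (x * realThetaThree x ^ 2) : ℝ) := by
  rw [← Complex.ofReal_neg, centeredElliptic_ofReal (by
    rw [abs_neg]
    exact abs_centeredLambda_lt_one hx), centeredLambda,
    show (1 + -(1 - 2 * (realThetaTwo x ^ 4 / realThetaThree x ^ 4))) / 2 =
      (realThetaTwo x ^ 2 / realThetaThree x ^ 2) ^ 2 by ring, Real.sqrt_sq (by positivity),
    agmIntegral_one_theta_ratio' hx]
  congr 1
  ring

theorem two_mul_quarterMoment_zero_mul_hypergeometric {x : ℝ} (hx : 0 < x) :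
    2 * quarterMoment 0 *
      ordinaryHypergeometric (1 / 4 : ℂ) (1 / 4) (1 / 2) ((centeredLambda x : ℂ) ^ 2) =
      (√2 * Real.pi * ((1 + x) * realThetaThree x ^ 2) : ℝ) := by
  rw [← centeredElliptic_add_neg (by simpa using abs_centeredLambda_lt_one hx),
    centeredElliptic_centeredLambda hx, centeredElliptic_neg_centeredLambda hx,
    ← Complex.ofReal_add]
  congr 1
  ring

theorem quarterMoment_one_mul_hypergeometric {x : ℝ} (hx : 0 < x) :
    quarterMoment 1 * (centeredLambda x *
      ordinaryHypergeometric (3 / 4 : ℂ) (3 / 4) (3 / 2) ((centeredLambda x : ℂ) ^ 2)) =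
      (√2 * Real.pi * ((x - 1) * realThetaThree x ^ 2) : ℝ) := by
  rw [← centeredElliptic_neg_sub (by simpa using abs_centeredLambda_lt_one hx),
    centeredElliptic_centeredLambda hx, centeredElliptic_neg_centeredLambda hx,
    ← Complex.ofReal_sub]
  congr 1
  ring

/-- The odd part of `C` at this parameter is a nonzero multiple of `(x - 1) θ₃(x)²`, and an odd
function vanishes at 0. -/
theorem centeredLambda_ne_zero {x : ℝ} (hx : 0 < x) (hx1 : x ≠ 1) : centeredLambda x ≠ 0 := by
  intro h0
  have h := quarterMoment_one_mul_hypergeometric hx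
  have h3 := realThetaThree_pos hx
  rw [h0, Complex.ofReal_zero, zero_mul, mul_zero, eq_comm, Complex.ofReal_eq_zero] at h
  have := sub_ne_zero.mpr hx1
  have hne : √2 * Real.pi * ((x - 1) * realThetaThree x ^ 2) ≠ 0 := by
    have := Real.pi_ne_zero
    positivity
  exact hne h

/-- At the fixed point of the inversion `θ₂ = θ₄`, so the two expressions for the parameter are
negatives of each other. -/
theorem centeredLambda_one : centeredLambda 1 = 0 := by
  have h := realThetaTwo_inv one_pos
  rw [inv_one, Real.sqrt_one, one_mul] at h
  have h1 := abs_centeredLambda_lt_one one_pos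
  have h2 := centeredLambda_eq one_pos
  rw [← h] at h2
  unfold centeredLambda at h2 ⊢
  linarith

theorem quarterMoment_zero_eq :
    2 * quarterMoment 0 = √2 * Real.pi * (2 * realThetaThree 1 ^ 2) := by
  have h := two_mul_quarterMoment_zero_mul_hypergeometric one_pos
  rw [centeredLambda_one, Complex.ofReal_zero, zero_pow two_ne_zero, ordinaryHypergeometric_zero,
    mul_one, one_add_one_eq_two] at h
  exact_mod_cast h

theorem hypergeometric_quarter_centeredLambda {x : ℝ} (hx : 0 < x) :
    ordinaryHypergeometric (1 / 4 : ℂ) (1 / 4) (1 / 2) ((centeredLambda x : ℂ) ^ 2) =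
      ((√((1 + x) / 2) * realThetaThree x / realThetaThree 1) ^ 2 : ℝ) := by
  have h := two_mul_quarterMoment_zero_mul_hypergeometric hx
  have h1 := realThetaThree_pos one_pos
  have hq := quarterMoment_zero_eq
  have h2 : (2 * quarterMoment 0 : ℂ) = ((√2 * Real.pi * (2 * realThetaThree 1 ^ 2) : ℝ) : ℂ) := by
    rw [← hq]
    push_cast
    rfl
  have hne : √2 * Real.pi * (2 * realThetaThree 1 ^ 2) ≠ 0 := by
    have := Real.pi_pos
    positivity
  rw [h2] at h
  refine mul_left_cancel₀ (Complex.ofReal_ne_zero.mpr hne) (h.trans ?_)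
  rw [← Complex.ofReal_mul, div_pow, mul_pow, Real.sq_sqrt (by positivity)]
  congr 1
  field_simp

theorem genV_centeredLambda {x : ℝ} (hx : 0 < x) :
    genV ((centeredLambda x : ℂ) ^ 2 / 4) =
      sigmaThree (((1 - x) / (1 + x) : ℝ) : ℂ) / thetaThree 1 := by
  have h1 := realThetaThree_pos one_pos
  have h3 := realThetaThree_pos hx
  rw [genV, mul_div_cancel₀ _ (by norm_num : (4 : ℂ) ≠ 0), hypergeometric_quarter_centeredLambda hx,
    sigmaThree_ofReal hx, thetaThree_one_eq, ← Complex.ofReal_div]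
  have : (1 / 2 : ℂ) = ((1 / 2 : ℝ) : ℂ) := by push_cast; rfl
  rw [this, ← Complex.ofReal_cpow (by positivity), ← Real.sqrt_eq_rpow, Real.sqrt_sq (by positivity)]

theorem genU_centeredLambda {x : ℝ} (hx : 0 < x) :
    (centeredLambda x : ℂ) ^ 2 / 4 * genU ((centeredLambda x : ℂ) ^ 2 / 4) ^ 2 =
      2 * thetaPhi * (((1 - x) / (1 + x) : ℝ) : ℂ) ^ 2 := by
  have h1 := two_mul_quarterMoment_zero_mul_hypergeometric hx
  have h2 := quarterMoment_one_mul_hypergeometric hx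
  rw [genU, mul_div_cancel₀ _ (by norm_num : (4 : ℂ) ≠ 0), thetaPhi_eq]
  have hF0 := re_hypergeometric_quarter_pos (v := (centeredLambda x : ℂ) ^ 2) (by
    rw [norm_pow]
    exact pow_lt_one₀ (norm_nonneg _) (by simpa using abs_centeredLambda_lt_one hx) two_ne_zero)
  set F := ordinaryHypergeometric (1 / 4 : ℂ) (1 / 4) (1 / 2) ((centeredLambda x : ℂ) ^ 2)
  set G := ordinaryHypergeometric (3 / 4 : ℂ) (3 / 4) (3 / 2) ((centeredLambda x : ℂ) ^ 2)
  have hF : F ≠ 0 := fun h => by rw [h] at hF0; exact lt_irrefl _ hF0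
  have hB0 : (quarterMoment 0 : ℂ) ≠ 0 := Complex.ofReal_ne_zero.mpr (quarterMoment_pos 0).ne'
  have hB1 : (quarterMoment 1 : ℂ) ≠ 0 := Complex.ofReal_ne_zero.mpr (quarterMoment_pos 1).ne'
  have hx1 : (1 + x : ℂ) ≠ 0 := by
    exact_mod_cast (by positivity : (1 + x : ℝ) ≠ 0)
  have key : (1 + x : ℂ) * (quarterMoment 1 * (centeredLambda x * G)) =
      (x - 1) * (2 * quarterMoment 0 * F) := by
    rw [h1, h2]
    push_cast
    ring
  push_cast
  field_simp
  -- The goal is the square of `key`; the multiplier is the cofactor in a difference of squares.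
  linear_combination ((1 + x : ℂ) * (quarterMoment 1 * (centeredLambda x * G)) +
      (x - 1) * (2 * quarterMoment 0 * F)) * key

/-! ### The identity theorem and uniqueness -/

theorem tendsto_centeredLambda_sq :
    Tendsto (fun x : ℝ => (centeredLambda x : ℂ) ^ 2 / 4) (𝓝[≠] 1) (𝓝[≠] 0) := by
  refine tendsto_nhdsWithin_iff.mpr ⟨?_, ?_⟩
  · have hcont : ∀ y : ℝ, 0 < y → ContinuousAt realThetaThree y := by
      intro y hy
      have h : ContinuousAt (fun x : ℝ => (thetaThree x).re) y :=
        Complex.continuous_re.continuousAt.comp (ContinuousAt.comp (f := fun x : ℝ => (x : ℂ))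
          (differentiableAt_thetaThree (by simpa using hy)).continuousAt
          Complex.continuous_ofReal.continuousAt)
      exact h.congr (Eventually.of_forall fun x => by
        simp only [thetaThree_ofReal, Complex.ofReal_re])
    -- Duplication gives `θ₂(x)² = θ₃(x/2)² - θ₃(x)²`, so only the continuity of `θ₃` is needed.
    have h1 : ContinuousAt (fun x => 1 - 2 * ((realThetaThree (x / 2) ^ 2 -
        realThetaThree x ^ 2) ^ 2 / realThetaThree x ^ 4)) 1 := by
      have ha := hcont 1 one_pos
      have hb : ContinuousAt (fun x => realThetaThree (x / 2)) 1 :=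
        ContinuousAt.comp (f := fun x : ℝ => x / 2) (hcont _ (by norm_num)) (by fun_prop)
      have hne : realThetaThree 1 ^ 4 ≠ 0 := (pow_pos (realThetaThree_pos one_pos) 4).ne'
      exact continuousAt_const.sub (continuousAt_const.mul
        ((((hb.pow 2).sub (ha.pow 2)).pow 2).div (ha.pow 4) hne))
    have h2 : ContinuousAt centeredLambda 1 := by
      refine h1.congr ?_
      filter_upwards [lt_mem_nhds (zero_lt_one' ℝ)] with x hx
      have := realThetaThree_sq (x := x / 2) (by linarith)
      rw [mul_div_cancel₀ _ two_ne_zero] at this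
      rw [this, add_sub_cancel_left, ← pow_mul]
      rfl
    have h3 : ContinuousAt (fun x : ℝ => (centeredLambda x : ℂ) ^ 2 / 4) 1 :=
      ((Complex.continuous_ofReal.continuousAt.comp h2).pow 2).div_const 4
    have h4 := h3.tendsto
    simp only [centeredLambda_one, Complex.ofReal_zero, zero_pow two_ne_zero, zero_div] at h4
    exact h4.mono_left nhdsWithin_le_nhds
  · filter_upwards [self_mem_nhdsWithin, nhdsWithin_le_nhds (lt_mem_nhds (zero_lt_one' ℝ))]
      with x hx1 hx
    have := Complex.ofReal_ne_zero.mpr (centeredLambda_ne_zero hx hx1)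
    exact div_ne_zero (pow_ne_zero 2 this) (by norm_num)

theorem genFunIdentityAt_iff {e : ℕ → ℝ} {t : ℂ} :
    GenFunIdentityAt e t ↔ HasSum (fun n : ℕ => (e n : ℂ) / (2 ^ n * (Nat.factorial (2 * n) : ℂ)) *
      (t * genU t ^ 2) ^ n) (genV t) := by
  unfold GenFunIdentityAt
  simp only [mul_pow, ← pow_mul, mul_assoc]

theorem genFunIdentityAt_dCoeff {t : ℂ} (ht : ‖t‖ < 1 / 4) : GenFunIdentityAt dCoeff t := by
  set c : ℕ → ℂ := fun n => (dCoeff n : ℂ) / (2 ^ n * (Nat.factorial (2 * n) : ℂ)) with hc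
  have hmaps : MapsTo (fun t : ℂ => t * genU t ^ 2) (Metric.ball 0 (1 / 4))
      (Metric.ball 0 (2 * thetaPhi)) := fun t ht =>
    mem_ball_zero_iff.mpr (norm_mul_genU_sq_lt (mem_ball_zero_iff.mp ht))
  have hf : DifferentiableOn ℂ (fun t => ∑' n, c n * (t * genU t ^ 2) ^ n)
      (Metric.ball 0 (1 / 4)) :=
    (differentiableOn_tsum_of_summable fun z hz => summable_dCoeff hz).comp
      (differentiableOn_id.mul (differentiableOn_genU.pow 2)) hmaps
  -- The theta parametrization supplies equality at points `t = u²/4 ≠ 0` tending to 0 as `x → 1`.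
  have hfreq : ∃ᶠ t in 𝓝[≠] (0 : ℂ), ∑' n, c n * (t * genU t ^ 2) ^ n = genV t := by
    refine tendsto_centeredLambda_sq.frequently (Eventually.frequently ?_)
    filter_upwards [nhdsWithin_le_nhds (lt_mem_nhds (zero_lt_one' ℝ))] with x hx
    rw [genV_centeredLambda hx]
    refine (hasSum_dCoeff_of_sq_eq ?_ (genU_centeredLambda hx)).tsum_eq
    rw [Complex.norm_real, Real.norm_eq_abs, abs_div, abs_of_pos (by positivity : 0 < 1 + x),
      div_lt_one (by positivity), abs_lt]
    constructor <;> linarith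
  have heq := (hf.analyticOnNhd Metric.isOpen_ball).eqOn_of_preconnected_of_frequently_eq
    (differentiableOn_genV.analyticOnNhd Metric.isOpen_ball)
    (convex_ball (0 : ℂ) (1 / 4)).isPreconnected (Metric.mem_ball_self (by norm_num)) hfreq
  rw [genFunIdentityAt_iff, ← heq (mem_ball_zero_iff.mpr ht)]
  exact (summable_dCoeff (norm_mul_genU_sq_lt ht)).hasSum

/-- Since `U(0) = 1`, the series variable stays nonzero near 0, so comparing coefficients along real
`t` is legitimate. -/
theorem tendsto_real_mul_genU_sq :
    Tendsto (fun t : ℝ => (t : ℂ) * genU t ^ 2) (𝓝[≠] 0) (𝓝[≠] 0) := by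
  have hU : ContinuousAt (fun t : ℝ => genU t) 0 := by
    have h : ContinuousAt genU ((0 : ℝ) : ℂ) := by
      rw [Complex.ofReal_zero]
      exact (differentiableOn_genU.differentiableAt
        (Metric.ball_mem_nhds 0 (by norm_num))).continuousAt
    exact h.comp (f := fun t : ℝ => (t : ℂ)) Complex.continuous_ofReal.continuousAt
  refine tendsto_nhdsWithin_iff.mpr ⟨?_, ?_⟩
  · have hc : ContinuousAt (fun t : ℝ => (t : ℂ)) 0 := Complex.continuous_ofReal.continuousAt
    have h := (hc.mul (hU.pow 2)).tendsto
    simp only [Pi.mul_apply, Complex.ofReal_zero, zero_mul] at h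
    exact h.mono_left nhdsWithin_le_nhds
  · have hne : ∀ᶠ t : ℝ in 𝓝 0, genU t ≠ 0 :=
      hU.eventually_ne (by rw [Complex.ofReal_zero, genU_zero]; exact one_ne_zero)
    filter_upwards [self_mem_nhdsWithin, nhdsWithin_le_nhds hne] with t ht hUt
    exact mul_ne_zero (Complex.ofReal_ne_zero.mpr ht) (pow_ne_zero 2 hUt)

theorem eq_dCoeff_of_genFunIdentityAt {e : ℕ → ℝ}
    (he : ∀ t : ℝ, |t| < 1 / 4 → GenFunIdentityAt e (t : ℂ)) : e = dCoeff := by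
  have h : (fun n : ℕ => (e n : ℂ) / (2 ^ n * (Nat.factorial (2 * n) : ℂ))) =
      fun n : ℕ => (dCoeff n : ℂ) / (2 ^ n * (Nat.factorial (2 * n) : ℂ)) := by
    refine powerSeries_coeff_eq_of_frequently
      (tendsto_real_mul_genU_sq.frequently (Eventually.frequently ?_))
    filter_upwards [nhdsWithin_le_nhds (Metric.ball_mem_nhds (0 : ℝ) (by norm_num :
      (0 : ℝ) < 1 / 4))] with t ht
    have ht' : |t| < 1 / 4 := by simpa using ht
    exact ⟨genV t, genFunIdentityAt_iff.mp (he t ht'),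
      genFunIdentityAt_iff.mp (genFunIdentityAt_dCoeff (by simpa using ht'))⟩
  ext n
  have hn := congrFun h n
  have hne : (2 ^ n * (Nat.factorial (2 * n) : ℂ)) ≠ 0 :=
    mul_ne_zero (pow_ne_zero _ two_ne_zero) (by exact_mod_cast (2 * n).factorial_ne_zero)
  exact_mod_cast (div_left_inj' hne).mp hn

theorem theorem3 :
    -- the defining Taylor expansion of the sequence `d`
    (∀ z : ℂ, ‖z‖ < 1 →
      HasSum (fun n : ℕ =>
        thetaThree 1 *
          ((dCoeff n : ℂ) / (Nat.factorial (2 * n) : ℂ) * (thetaPhi : ℂ) ^ n * z ^ (2 * n)))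
        (sigmaThree z)) ∧
    -- `d` satisfies the generating function identity on the whole complex disc
    (∀ t : ℂ, ‖t‖ < 1 / 4 → GenFunIdentityAt dCoeff t) ∧
    -- `d` is the only real sequence that does, even if only real `t` are considered
    (∀ e : ℕ → ℝ, (∀ t : ℝ, |t| < 1 / 4 → GenFunIdentityAt e (t : ℂ)) → e = dCoeff) :=
  ⟨fun _ hz => hasSum_dCoeff_sigmaThree hz, fun _ ht => genFunIdentityAt_dCoeff ht,
    fun _ he => eq_dCoeff_of_genFunIdentityAt he⟩
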